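/- Let $n\ge 2$, $1\le m\le n$, and let $f_1,\dots,f_n:\mathbb R^d\to\mathbb R$ be differentiable, with $f=\frac1n\sum_{i=1}^n f_i$ bounded below, $f^\star=\inf f$ and $h_i=f-f_i$. For a set $A\subseteq[n]$ put $f_A=\frac1{|A|}\sum_{i\in A}f_i$. Assume that for some $\Delta_1,\delta,L_1>0$ and all $x,y\in\mathbb R^d$, $$\|\nabla h_1(x)-\nabla h_1(y)\|\le\Delta_1\|x-y\|,\qquad \frac1n\sum_{i=1}^n\|\nabla h_i(x)-\nabla h_i(y)\|^2\le\delta^2\|x-y\|^2,\qquad \|\nabla f_1(x)-\nabla f_1(y)\|\le L_1\|x-y\|.$$ Let $n_m=\frac nm$, $q_m=\frac{n-m}{n-1}$, $\delta_m=\sqrt{\frac{q_m}{m}\delta^2}$, let $x^0\in\mathbb R^d$ with $F^0:=f(x^0)-f^\star>0$, let $\epsilon>0$, and set $$\lambda=3\Delta_1+113\sqrt{n_m}\,\delta_m,\quad \beta=\frac1{112\,n_m},\quad p=\frac{\lambda-\Delta_1}{8(L_1+\lambda)},\quad T=\left\lceil\frac{256(\Delta_1+38\sqrt{n_m}\,\delta_m)F^0}{\epsilon^2}\right\rceil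 .$$ **The method I-CGM-RG-SAGA.** Let $S_0,S_1,\dots$ be uniformly distributed on the $m$-element subsets of $[n]$, let $\hat K_0,\hat K_1,\dots$ satisfy $\mathbb P(\hat K_t=k)=(1-p)^kp$ for $k\ge0$, let $\tau$ be uniform on $\{1,\dots,T\}$, and let all of these be mutually independent. Let $g^0=\nabla f(x^0)$. For $t\ge0$: * $x^{t+1}=y^t_{\hat K_t+1}$, where $y^t_0=x^t$ and $y^t_{k+1}=\frac1{\lambda+L_1}\bigl(L_1y^t_k+\lambda x^t+\nabla f_1(x^t)-g^t-\nabla f_1(y^t_k)\bigr)$ (composite gradient steps for $\min_x\, f_1(x)+h_1(x^t)+\langle g^t-\nabla f_1(x^t),x-x^t\rangle+\frac\lambda2\|x-x^t\|^2$); * $b^t_i=\nabla f_i(x^t)$ if $t\le1$ or $i\in S_t$, and $b^t_i=b^{t-1}_i$ otherwise; $G^t=\nabla f(x^t)$ if $t\le 1$, and $G^t=\frac1m\sum_{i\in S_t}(b_i^t-b_i^{t-1})+\frac1n\sum_{i=1}^nb_i^{t-1}$ if $t\ge2$; * $g^{t+1}=(1-\beta)g^t+\beta G^t+\nabla f_{S_t}(x^{t+1})-\nabla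 f_{S_t}(x^t)$. The output after $T$ iterations is $\bar x^T=x^\tau$. **Complexities.** In a federated algorithm, a server proceeds in communication rounds. In each round it selects a set of clients, either an arbitrary $m$-element set (cost $C_A$), or a uniformly random $m$-element set (cost $C_R$), or client $1$ alone (cost $1$), where $1\le C_R\le C_A$. Each selected client $i$ runs a local method that queries the first-order oracle $x\mapsto(f_i(x),\nabla f_i(x))$, and sends a response to the server. The communication complexity is the expected total cost of the rounds; the local complexity is the expectation of the sum, over the rounds, of the maximal number of oracle queries made by a selected client. The method is implemented as follows: at $t=0$ and $t=1$ all gradients $\nabla f_i(x^t)$ are collected in $\lceil n_m\rceil$ rounds of the first kind; in every iteration $t=0,\dots,T-1$, client $1$ computes $x^{t+1}$ in one round of the third kind, and the clients in $S_t$ compute $\nabla f_i(x^t)$ and $\nabla f_i(x^{t+1})$ in one round of the second kind. **Claim.** This implementation outputs $\bar x^T$ (almost surely), and $$\mathbb E\,\|\nabla f(\bar x^T)\|^2\le\epsilon^2 .$$ Its communication complexity is at most $$2C_A\lceil n_m\rceil+(C_R+1)\left\lceil\frac{256(\Delta_1+38\sqrt{n_m}\,\delta_m)F^0}{\epsilon^2}\right\rceil,$$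 and its local complexity is at most $$14+2\lceil n_m\rceil+\frac{512(7\Delta_1+283\sqrt{n_m}\,\delta_m+2L_1)F^0}{\epsilon^2}+\frac{4L_1}{\Delta_1+28\sqrt{n_m}\,\delta_m}.$$ -/

import Mathlib

open MeasureTheory ProbabilityTheory
open scoped ENNReal

noncomputable section

namespace FedOpt

/-- The Euclidean space `ℝ^d`. -/
abbrev Vec (d : ℕ) : Type := EuclideanSpace ℝ (Fin d)

variable {n m d : ℕ}

/-! ### The problem -/

/-- The average `(1/|A|) ∑_{i ∈ A} v_i` of vectors over a set of clients. -/
def mean (A : Finset (Fin n)) (v : Fin n → Vec d) : Vec d :=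
  (A.card : ℝ)⁻¹ • ∑ i ∈ A, v i

/-- The average function `f_A = (1/|A|) ∑_{i ∈ A} f_i` over a set of clients. -/
def meanFun (f : Fin n → Vec d → ℝ) (A : Finset (Fin n)) (x : Vec d) : ℝ :=
  (A.card : ℝ)⁻¹ * ∑ i ∈ A, f i x

/-- The objective `f = (1/n) ∑_i f_i`. -/
def objective (f : Fin n → Vec d → ℝ) : Vec d → ℝ :=
  meanFun f Finset.univ

/-- The difference function `h_i = f - f_i`. -/
def diffFun (f : Fin n → Vec d → ℝ) (i : Fin n) (x : Vec d) : ℝ :=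
  objective f x - f i x

/-- `F⁰ = f(x⁰) - inf f`. -/
def initialGap (f : Fin n → Vec d → ℝ) (x₀ : Vec d) : ℝ :=
  objective f x₀ - ⨅ x, objective f x

/-- `n_m = n / m`. -/
def ratio (n m : ℕ) : ℝ := (n : ℝ) / m

/-- `δ_m`, where `δ_m² = (q_m / m) δ²` and `q_m = (n - m) / (n - 1)`. -/
def deltaM (n m : ℕ) (δ : ℝ) : ℝ :=
  Real.sqrt ((((n : ℝ) - m) / ((n : ℝ) - 1)) / m * δ ^ 2)

/-! ### The method I-CGM-RG-SAGA as a recursion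

The first client, `0 : Fin n`, is the delegate client.  The sets `S_t` and the numbers `K̂_t`
are arbitrary sequences here; they are made random below. -/

/-- One step `y ↦ y⁺` of the composite gradient method for the subproblem
`F_t(z) = f₁(z) + h₁(x) + ⟪g - ∇f₁(x), z - x⟫ + (lam/2)‖z - x‖²`.  With `gx = ∇f₁(x)` and
`gy = ∇f₁(y)`, the point `y⁺` is the minimizer over `z` of
`⟪gy, z - y⟫ + (L/2)‖z - y‖² + ⟪g - gx, z - x⟫ + (lam/2)‖z - x‖²`. -/
def cgmStep (lam L : ℝ) (x g gx y gy : Vec d) : Vec d :=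
  (lam + L)⁻¹ • (L • y + lam • x + gx - g - gy)

/-- `CGM_rand(lam, K, x, g)`: starting at `y_0 = x`, the point `y_{K+1}` after `K + 1` steps. -/
def cgmRand (lam L : ℝ) (f₁ : Vec d → ℝ) (K : ℕ) (x g : Vec d) : Vec d :=
  (fun y => cgmStep lam L x g (gradient f₁ x) y (gradient f₁ y))^[K + 1] x

/-- The SAGA table `b^t` from `x = x^t`, `A = S_t` and `b = b^{t-1}`. -/
def sagaTable (f : Fin n → Vec d → ℝ) (t : ℕ) (x : Vec d) (A : Finset (Fin n))
    (b : Fin n → Vec d) : Fin n → Vec d := fun i =>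
  if t ≤ 1 then gradient (f i) x else if i ∈ A then gradient (f i) x else b i

/-- The SAGA estimator `G^t` from `x = x^t`, `A = S_t` and `b = b^{t-1}`: it is `∇f(x^t)` for
`t = 0, 1` and `b^t_{S_t} - b^{t-1}_{S_t} + (1/n) ∑_i b^{t-1}_i` for `t ≥ 2`. -/
def sagaEstimator (f : Fin n → Vec d → ℝ) (t : ℕ) (x : Vec d) (A : Finset (Fin n))
    (b : Fin n → Vec d) : Vec d :=
  if t ≤ 1 then gradient (objective f) x
  else mean A (sagaTable f t x A b) - mean A b + mean Finset.univ b

/-- The RG update `g^{t+1} = (1-β) g^t + β G^t + ∇f_{S_t}(x^{t+1}) - ∇f_{S_t}(x^t)`. -/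
def rgUpdate (f : Fin n → Vec d → ℝ) (β : ℝ) (A : Finset (Fin n)) (x x' g G : Vec d) : Vec d :=
  (1 - β) • g + β • G + gradient (meanFun f A) x' - gradient (meanFun f A) x

/-- The iterate `x = x^t`, the estimator `g = g^t`, and the table `b = b^{t-1}`. -/
structure IterState (n d : ℕ) where
  x : Vec d
  g : Vec d
  b : Fin n → Vec d

/-- The state of I-CGM-RG-SAGA at the beginning of iteration `t`.  (The table of the state at
`t = 0` is never read.) -/
def iterState [NeZero n] (f : Fin n → Vec d → ℝ) (lam L β : ℝ) (x₀ : Vec d)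
    (S : ℕ → Finset (Fin n)) (K : ℕ → ℕ) : ℕ → IterState n d
  | 0 => ⟨x₀, gradient (objective f) x₀, fun _ => 0⟩
  | t + 1 =>
    let s := iterState f lam L β x₀ S K t
    let x' := cgmRand lam L (f 0) (K t) s.x s.g
    ⟨x', rgUpdate f β (S t) s.x x' s.g (sagaEstimator f t s.x (S t) s.b),
      sagaTable f t s.x (S t) s.b⟩

/-- The iterate `x^t` of I-CGM-RG-SAGA. -/
def iterate [NeZero n] (f : Fin n → Vec d → ℝ) (lam L β : ℝ) (x₀ : Vec d)
    (S : ℕ → Finset (Fin n)) (K : ℕ → ℕ) (t : ℕ) : Vec d :=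
  (iterState f lam L β x₀ S K t).x

/-- The randomness of the method: `S_0, S_1, …` are uniform among the `m`-element sets of clients,
`K_0, K_1, …` are geometric with `ℙ(K_t = k) = (1-p)^k p`, the index `τ` of the output is uniform
on `{1, …, T}`, and all of these random variables are mutually independent. -/
structure IsRandomness {Ω : Type*} [MeasurableSpace Ω] (P : Measure Ω) (m : ℕ) (p : ℝ) (T : ℕ)
    (S : ℕ → Ω → Finset (Fin n)) (K : ℕ → Ω → ℕ) (τ : Ω → ℕ) : Prop where
  measurable_S : ∀ t, Measurable (S t)
  measurable_K : ∀ t, Measurable (K t)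
  measurable_τ : Measurable τ
  law_S : ∀ t, ∀ A : Finset (Fin n), A.card = m →
    P {ω | S t ω = A} = ENNReal.ofReal (1 / (n.choose m : ℝ))
  law_K : ∀ t k, P {ω | K t ω = k} = ENNReal.ofReal ((1 - p) ^ k * p)
  law_τ : ∀ s ∈ Finset.Icc 1 T, P {ω | τ ω = s} = ENNReal.ofReal (1 / (T : ℝ))
  indep_time : iIndepFun (fun t ω => (S t ω, K t ω)) P
  indep_S_K : ∀ t, IndepFun (S t) (K t) P
  indep_τ : IndepFun τ (fun ω t => (S t ω, K t ω)) P

/-! ### Federated optimization algorithms and their complexity -/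

/-- A local method: at each step it either stops with a result or queries the oracle of the client
at a point and continues according to the response (a function value and a gradient). -/
inductive LocalMethod (d : ℕ) (α : Type) : Type
  | done (result : α) : LocalMethod d α
  | query (x : Vec d) (next : ℝ × Vec d → LocalMethod d α) : LocalMethod d α

/-- The result of a local method run with the oracle `O`. -/
def LocalMethod.result {α : Type} (O : Vec d → ℝ × Vec d) : LocalMethod d α → α
  | .done r => r
  | .query x next => (next (O x)).result O

/-- The number of oracle queries made by a local method run with the oracle `O`. -/
def LocalMethod.numQueries {α : Type} (O : Vec d → ℝ × Vec d) : LocalMethod d α → ℕ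
  | .done _ => 0
  | .query x next => (next (O x)).numQueries O + 1

/-- The client-selection strategies: an arbitrary set of `m` clients (ASS), a random set of `m`
clients (RSS), or the delegate client alone (DSS). -/
inductive Selection (n m : ℕ) : Type
  | arbitrary (A : Finset (Fin n)) (hA : A.card = m) : Selection n m
  | random : Selection n m
  | delegate : Selection n m

/-- A federated optimization algorithm (for given values of its internal random numbers), with
client information of type `H` and responses of type `R`.  It either terminates with an output, or
makes a communication round: it selects clients and gives each client `i` a method, which starts
from the stored information of the client and ends with the updated information and a response; it
continues according to the selected set and to the responses, which come from the selected
clients only. -/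
inductive Algorithm (n m d : ℕ) (H R : Type) : Type
  | halt (output : Vec d) : Algorithm n m d H R
  | round (sel : Selection n m) (method : Fin n → H → LocalMethod d (H × R))
      (next : Finset (Fin n) → (Fin n → Option R) → Algorithm n m d H R) : Algorithm n m d H R

/-- What is recorded of a run: the output, the numbers of times that ASS, RSS and DSS are used, and
the sum over the rounds of the maximal number of queries made by a selected client. -/
structure Outcome (d : ℕ) where
  output : Vec d
  numA : ℕ
  numR : ℕ
  numD : ℕ
  localSteps : ℕ

/-- The selected set of a round, when the random set is `A'` in case of RSS. -/
def Selection.clients [NeZero n] (A' : Finset (Fin n)) : Selection n m → Finset (Fin n)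
  | .arbitrary A _ => A
  | .random => A'
  | .delegate => {0}

/-- `1` for ASS and `0` otherwise. -/
def Selection.countA : Selection n m → ℕ
  | .arbitrary _ _ => 1
  | .random => 0
  | .delegate => 0

/-- `1` for RSS and `0` otherwise. -/
def Selection.countR : Selection n m → ℕ
  | .arbitrary _ _ => 0
  | .random => 1
  | .delegate => 0

/-- `1` for DSS and `0` otherwise. -/
def Selection.countD : Selection n m → ℕ
  | .arbitrary _ _ => 0
  | .random => 0
  | .delegate => 1

/-- The run of an algorithm when `O i` is the oracle of client `i`, the `j`-th use of RSS
yields the set `S j`, `r` is the number of uses of RSS so far, and `h i` is the current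
information of client `i`. -/
def Algorithm.run [NeZero n] {H R : Type} (O : Fin n → Vec d → ℝ × Vec d)
    (S : ℕ → Finset (Fin n)) : Algorithm n m d H R → ℕ → (Fin n → H) → Outcome d
  | .halt x, _, _ => ⟨x, 0, 0, 0, 0⟩
  | .round sel method next, r, h =>
    let A := sel.clients (S r)
    let res := fun i => (method i (h i)).result (O i)
    let rest := (next A (fun i => if i ∈ A then some (res i).2 else none)).run O S
      (r + sel.countR) (fun i => if i ∈ A then (res i).1 else h i)
    ⟨rest.output, rest.numA + sel.countA, rest.numR + sel.countR, rest.numD + sel.countD,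
      rest.localSteps + A.sup (fun i => (method i (h i)).numQueries (O i))⟩

/-- The deterministic first-order oracle of a function. -/
def firstOrderOracle (φ : Vec d → ℝ) (x : Vec d) : ℝ × Vec d := (φ x, gradient φ x)

/-- The communication complexity `𝔼[C_A N_A + C_R N_R + N_D]` of a random run. -/
def commComplexity {Ω : Type*} [MeasurableSpace Ω] (P : Measure Ω) (C_A C_R : ℝ)
    (Z : Ω → Outcome d) : ℝ≥0∞ :=
  ∫⁻ ω, ENNReal.ofReal (C_A * (Z ω).numA + C_R * (Z ω).numR + (Z ω).numD) ∂P

/-- The local complexity `𝔼[∑_r K_r]`, `K_r = max_{i ∈ S_r} K_i^r`, of a random run. -/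
def localComplexity {Ω : Type*} [MeasurableSpace Ω] (P : Measure Ω) (Z : Ω → Outcome d) : ℝ≥0∞ :=
  ∫⁻ ω, ((Z ω).localSteps : ℝ≥0∞) ∂P

/-! ### I-CGM-RG-SAGA as a federated optimization algorithm

Client `i` stores the vector `b_i`.  Responses are pairs of vectors. -/

/-- The `j`-th block of `m` consecutive clients, with the last one shifted to end at `n`. -/
def block (n m j : ℕ) : Finset (Fin n) :=
  Finset.univ.filter (fun i => min (j * m) (n - m) ≤ (i : ℕ) ∧ (i : ℕ) < min (j * m) (n - m) + m)

theorem card_block (hmn : m ≤ n) (j : ℕ) : (block n m j).card = m := by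
  have h : (block n m j).map Fin.valEmbedding
      = Finset.Ico (min (j * m) (n - m)) (min (j * m) (n - m) + m) := by
    ext k
    simp only [block, Finset.mem_map, Finset.mem_filter, Finset.mem_univ, true_and,
      Fin.valEmbedding_apply, Finset.mem_Ico]
    constructor
    · rintro ⟨i, hi, rfl⟩
      exact hi
    · intro hk
      have h1 : min (j * m) (n - m) ≤ n - m := min_le_right _ _
      exact ⟨⟨k, by omega⟩, hk, rfl⟩
  rw [← Finset.card_map Fin.valEmbedding, h, Nat.card_Ico]
  omega

/-- Full synchronization at `x`, one ASS round for each of the blocks `j - 1, …, 0`: every client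
computes `∇f_i(x)`, stores it and sends it; the server collects the vectors in a table. -/
def fullSync (hmn : m ≤ n) (x : Vec d) :
    ℕ → (Fin n → Vec d) → ((Fin n → Vec d) → Algorithm n m d (Vec d) (Vec d × Vec d)) →
      Algorithm n m d (Vec d) (Vec d × Vec d)
  | 0, table, next => next table
  | j + 1, table, next =>
    .round (.arbitrary (block n m j) (card_block hmn j))
      (fun _ _ => .query x (fun o => .done (o.2, (o.2, 0))))
      (fun _ resp =>
        fullSync hmn x j (fun i => match resp i with
          | some v => v.1
          | none => table i) next)

/-- Local CGM steps at the delegate client: `k` further steps from `y`, each with one query. -/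
def localCGM (lam L : ℝ) (x g gx : Vec d) (h : Vec d) :
    ℕ → Vec d → LocalMethod d (Vec d × (Vec d × Vec d))
  | 0, y => .done (h, (y, 0))
  | k + 1, y => .query y (fun o => localCGM lam L x g gx h k (cgmStep lam L x g gx y o.2))

/-- The local method for `CGM_rand(lam, K, x, g)`, whose first query also yields `∇f₁(x)`. -/
def localCGMRand (lam L : ℝ) (K : ℕ) (x g h : Vec d) : LocalMethod d (Vec d × (Vec d × Vec d)) :=
  .query x (fun o => localCGM lam L x g o.2 h K (cgmStep lam L x g o.2 x o.2))

/-- The local method of the clients in `S_t`: client `i`, with stored vector `b_i`, computes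
`∇f_i(x)` and `∇f_i(x')` for `x = x^t` and `x' = x^{t+1}`, replaces `b_i` by `∇f_i(x)`, and sends
`∇f_i(x') - ∇f_i(x)` and `∇f_i(x) - b_i`. -/
def localDiff (x x' b : Vec d) : LocalMethod d (Vec d × (Vec d × Vec d)) :=
  .query x (fun o => .query x' (fun o' => .done (o.2, (o'.2 - o.2, o.2 - b))))

/-- The second half of an iteration, where `x = x^t`, `g = g^t`, and `b` is the average of the
vectors stored at the clients: a DSS round computes `x^{t+1}`, and an RSS round with the set `S_t`
then yields `g^{t+1}` and the new average. -/
def mainRounds [NeZero n] (lam L β : ℝ) (K : ℕ) (x g b : Vec d)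
    (next : Vec d → Vec d → Vec d → Algorithm n m d (Vec d) (Vec d × Vec d)) :
    Algorithm n m d (Vec d) (Vec d × Vec d) :=
  .round .delegate (fun _ h => localCGMRand lam L K x g h) (fun _ resp₁ =>
    let x' := ((resp₁ 0).getD (0, 0)).1
    .round .random (fun _ h => localDiff x x' h) (fun A resp =>
      let u := fun i => ((resp i).getD (0, 0)).1
      let v := fun i => ((resp i).getD (0, 0)).2
      next x' ((1 - β) • g + β • (mean A v + b) + mean A u)
        (b + (n : ℝ)⁻¹ • ∑ i ∈ A, v i)))

/-- The iterations `t, …, t + k - 1`.  Iterations `0` and `1` start with a full synchronization,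
and iteration `0` takes `g^0 = ∇f(x^0)`.  The output is `x^τ`, kept in `out` once it is known. -/
def mainLoop [NeZero n] (hmn : m ≤ n) (lam L β : ℝ) (K : ℕ → ℕ) (τ : ℕ) :
    ℕ → ℕ → Vec d → Vec d → Vec d → Vec d → Algorithm n m d (Vec d) (Vec d × Vec d)
  | 0, _, _, _, _, out => .halt out
  | k + 1, t, x, g, b, out =>
    let cont := fun x' g' b' =>
      mainLoop hmn lam L β K τ k (t + 1) x' g' b' (if t + 1 = τ then x' else out)
    if t ≤ 1 then
      fullSync hmn x ⌈ratio n m⌉₊ (fun _ => 0) (fun table =>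
        let b' := mean Finset.univ table
        mainRounds lam L β (K t) x (if t = 0 then b' else g) b' cont)
    else mainRounds lam L β (K t) x g b cont

/-- I-CGM-RG-SAGA with `T` iterations from `x₀`, with the numbers `K t` of local steps and the
index `τ` of the output as its internal random numbers. -/
def icgmRGSAGA [NeZero n] (hmn : m ≤ n) (lam L β : ℝ) (x₀ : Vec d) (T : ℕ) (K : ℕ → ℕ) (τ : ℕ) :
    Algorithm n m d (Vec d) (Vec d × Vec d) :=
  mainLoop hmn lam L β K τ T 0 x₀ 0 0 x₀

/-- The run of I-CGM-RG-SAGA on the problem given by `f`. -/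
def runICGM [NeZero n] (f : Fin n → Vec d → ℝ) (hmn : m ≤ n) (lam L β : ℝ) (x₀ : Vec d) (T : ℕ)
    (S : ℕ → Finset (Fin n)) (K : ℕ → ℕ) (τ : ℕ) : Outcome d :=
  (icgmRGSAGA hmn lam L β x₀ T K τ).run (fun i => firstOrderOracle (f i)) S 0 (fun _ => 0)

end FedOpt

end

namespace FedOpt

open scoped RealInnerProductSpace

variable {n m d : ℕ}

/-! ### Gradients of averages -/

/-! The rate comes from a potential whose expectation drops by at least the expected squared
gradient norm at the new iterate. Write M = lam - Δ₁, ρ = n/m and Q = `samplingFactor n m`, and let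
e = ‖g - ∇f(x)‖ be the estimator error.

Local work: the delegate minimizes a model of f = f₁ + h₁ that is exact in f₁ and linear in h₁. A
composite gradient step lowers the model by a multiple of its squared gradient. For p = M/(8(L₁ +
lam)) the geometric weights make these decreases telescope, so a random number of steps gives an
expected 70M(f - c) + (5/2)‖∇f‖² + (3/2)M²‖x' - x‖² of at most the old 70M(f - c) plus 80e²
(`sum_geometric_potential_le`). The smoothness L₁ enters only through p, that is, through the number
of local steps.

Estimator: the new error is (1 - β) times the old one plus a centered sampling error, whose variance
carries the factor Q of sampling without replacement (`sampleMean_norm_add_mean_sq`). Since ∇f_i =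
∇f - ∇h_i, a suitable centering leaves only differences of the ∇h_i, controlled by δ, and β∇f at the
SAGA points (`sampleMean_estimator_error_le'`). The smoothness of f is not used there.

`potential` therefore adds to 70M(f - c) the squared error, the deviation of the ∇h_i from their
values at the SAGA points, and squared norms of ∇f at those points and at x. Its weights make every
loss fit into a gain (`sampleMean_potential_le`). The synchronization at t = 1 lets the accounting
start from 70M F⁰ alone: squared gradient norms at x⁰ never enter, and those at x¹ are paid for by
the first local phase. Summing over t and averaging over τ gives 70M F⁰/T ≤ ε².

The complexity bounds follow by identifying the federated run with the recursion (`run_mainLoop`)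
and using 𝔼(K̂ + 1) = 1/p. -/

theorem hasGradientAt_meanFun {f : Fin n → Vec d → ℝ} (hf : ∀ i, Differentiable ℝ (f i))
    (A : Finset (Fin n)) (x : Vec d) :
    HasGradientAt (meanFun f A) (mean A fun i => gradient (f i) x) x := by
  have h : HasFDerivAt (∑ i ∈ A, f i) (∑ i ∈ A, fderiv ℝ (f i) x) x :=
    HasFDerivAt.sum fun i _ => (hf i x).hasFDerivAt
  have h' := h.const_mul (A.card : ℝ)⁻¹
  rw [hasGradientAt_iff_hasFDerivAt]
  have e : meanFun f A = fun y => (A.card : ℝ)⁻¹ * (∑ i ∈ A, f i) y := by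
    ext y
    simp [meanFun]
  rw [e]
  refine h'.congr_fderiv ?_
  simp only [mean, map_smul, map_sum, toDual_gradient]

theorem differentiable_meanFun {f : Fin n → Vec d → ℝ} (hf : ∀ i, Differentiable ℝ (f i))
    (A : Finset (Fin n)) : Differentiable ℝ (meanFun f A) := fun x =>
  (hasGradientAt_meanFun hf A x).differentiableAt

theorem gradient_meanFun {f : Fin n → Vec d → ℝ} (hf : ∀ i, Differentiable ℝ (f i))
    (A : Finset (Fin n)) (x : Vec d) :
    gradient (meanFun f A) x = mean A fun i => gradient (f i) x :=
  (hasGradientAt_meanFun hf A x).gradient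

theorem gradient_objective {f : Fin n → Vec d → ℝ} (hf : ∀ i, Differentiable ℝ (f i))
    (x : Vec d) : gradient (objective f) x = mean Finset.univ fun i => gradient (f i) x :=
  gradient_meanFun hf _ x

theorem differentiable_diffFun {f : Fin n → Vec d → ℝ} (hf : ∀ i, Differentiable ℝ (f i))
    (i : Fin n) : Differentiable ℝ (diffFun f i) :=
  (differentiable_meanFun hf Finset.univ).sub (hf i)

theorem gradient_diffFun {f : Fin n → Vec d → ℝ} (hf : ∀ i, Differentiable ℝ (f i))
    (i : Fin n) (x : Vec d) :
    gradient (diffFun f i) x = gradient (objective f) x - gradient (f i) x := by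
  have h1 := ((differentiable_meanFun hf Finset.univ) x).hasGradientAt
  have h2 := (hf i x).hasGradientAt
  rw [hasGradientAt_iff_hasFDerivAt] at h1 h2
  have h3 := h1.sub h2
  rw [← map_sub, ← hasGradientAt_iff_hasFDerivAt] at h3
  exact h3.gradient

/-! ### The descent lemma -/

/-- Along the segment, φ minus the quadratic upper model has nonpositive derivative by
Cauchy–Schwarz, hence is antitone on [0, 1]. No integral of the gradient is needed. -/
theorem le_add_inner_add_sq_of_lipschitz_gradient {φ : Vec d → ℝ} (hφ : Differentiable ℝ φ)
    {L : ℝ} (hL : ∀ x y, ‖gradient φ x - gradient φ y‖ ≤ L * ‖x - y‖) (x y : Vec d) :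
    φ y ≤ φ x + ⟪gradient φ x, y - x⟫ + L / 2 * ‖y - x‖ ^ 2 := by
  set v := y - x with hv
  have hline : ∀ t : ℝ, HasDerivAt (fun t : ℝ => x + t • v) v t := fun t => by
    simpa using ((hasDerivAt_id t).smul_const v).const_add x
  have hφt : ∀ t : ℝ, HasDerivAt (fun t : ℝ => φ (x + t • v)) ⟪gradient φ (x + t • v), v⟫ t := by
    intro t
    have h := (hφ (x + t • v)).hasFDerivAt.comp_hasDerivAt t (hline t)
    rwa [← inner_gradient_left] at h
  have hd : ∀ t : ℝ, HasDerivAt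
      (fun t : ℝ => φ (x + t • v) - t * ⟪gradient φ x, v⟫ - L / 2 * t ^ 2 * ‖v‖ ^ 2)
      (⟪gradient φ (x + t • v), v⟫ - ⟪gradient φ x, v⟫ - L * t * ‖v‖ ^ 2) t := by
    intro t
    have h := ((hφt t).sub ((hasDerivAt_id t).mul_const ⟪gradient φ x, v⟫)).sub
      (((hasDerivAt_pow 2 t).const_mul (L / 2)).mul_const (‖v‖ ^ 2))
    refine h.congr_deriv ?_
    rw [show 2 - 1 = 1 from rfl]
    push_cast
    ring
  have hanti := antitoneOn_of_deriv_nonpos (convex_Icc (0 : ℝ) 1)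
    (fun t _ => (hd t).continuousAt.continuousWithinAt)
    (fun t _ => (hd t).differentiableAt.differentiableWithinAt) (by
      intro t ht
      rw [interior_Icc] at ht
      rw [(hd t).deriv, ← inner_sub_left]
      have h1 := real_inner_le_norm (gradient φ (x + t • v) - gradient φ x) v
      have h2 := hL (x + t • v) x
      rw [add_sub_cancel_left, norm_smul, Real.norm_of_nonneg ht.1.le] at h2
      nlinarith [norm_nonneg v, mul_le_mul_of_nonneg_right h2 (norm_nonneg v)])
  have h := hanti (Set.left_mem_Icc.2 zero_le_one) (Set.right_mem_Icc.2 zero_le_one) zero_le_one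
  simp only [one_smul, zero_smul, add_zero, one_mul, zero_mul, one_pow, mul_one, sub_zero, ne_eq,
    OfNat.ofNat_ne_zero, not_false_eq_true, zero_pow, mul_zero] at h
  rw [show x + v = y by rw [hv]; abel] at h
  linarith

/-! ### The composite gradient method with a random number of steps -/

/-- The model `φ(y) + ψ(x) + ⟪g - ∇φ(x), y - x⟫ + (lam/2)‖y - x‖²` of `φ + ψ` at `x`. -/
noncomputable def model (φ ψ : Vec d → ℝ) (lam : ℝ) (x g y : Vec d) : ℝ :=
  φ y + ψ x + ⟪g - gradient φ x, y - x⟫ + lam / 2 * ‖y - x‖ ^ 2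

/-- The gradient of the model at `y`. -/
noncomputable def modelGrad (φ : Vec d → ℝ) (lam : ℝ) (x g y : Vec d) : Vec d :=
  gradient φ y + (g - gradient φ x) + lam • (y - x)

/-- The map `y ↦ y⁺` of the composite gradient method. -/
noncomputable def cgmMap (φ : Vec d → ℝ) (lam L : ℝ) (x g y : Vec d) : Vec d :=
  cgmStep lam L x g (gradient φ x) y (gradient φ y)

section CGM

variable {φ ψ : Vec d → ℝ} {lam L Δ c p : ℝ}

theorem model_self (x g : Vec d) : model φ ψ lam x g x = φ x + ψ x := by simp [model]

/-- First-order optimality of the step: the gradient of the model vanishes once φ is replaced by its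
quadratic upper bound at y. -/
theorem cgmMap_spec (h : 0 < lam + L) (x g y : Vec d) :
    gradient φ y + L • (cgmMap φ lam L x g y - y) + (g - gradient φ x)
      + lam • (cgmMap φ lam L x g y - x) = 0 := by
  have h1 : (lam + L) • cgmMap φ lam L x g y
      = L • y + lam • x + gradient φ x - g - gradient φ y := by
    rw [cgmMap, cgmStep, smul_inv_smul₀ h.ne']
  rw [add_smul] at h1
  have h2 : gradient φ y + L • (cgmMap φ lam L x g y - y) + (g - gradient φ x)
      + lam • (cgmMap φ lam L x g y - x)
      = (lam • cgmMap φ lam L x g y + L • cgmMap φ lam L x g y)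
        - (L • y + lam • x + gradient φ x - g - gradient φ y) := by
    module
  rw [h2, h1, sub_self]

/-- The descent lemma costs (L/2)‖z - y‖². Testing the optimality condition against z - y gains L‖z
- y‖², and expanding ‖y - x‖² around z gains (lam/2)‖z - y‖². -/
theorem model_cgmMap_le (hφ : Differentiable ℝ φ) (h : 0 < lam + L)
    (hL : ∀ x y, ‖gradient φ x - gradient φ y‖ ≤ L * ‖x - y‖) (x g y : Vec d) :
    model φ ψ lam x g (cgmMap φ lam L x g y)
        + (L + lam) / 2 * ‖cgmMap φ lam L x g y - y‖ ^ 2 ≤ model φ ψ lam x g y := by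
  set z := cgmMap φ lam L x g y with hz
  have hd := le_add_inner_add_sq_of_lipschitz_gradient hφ hL y z
  have hs := congrArg (fun w => ⟪w, z - y⟫) (cgmMap_spec (φ := φ) h x g y)
  simp only [← hz, inner_add_left, real_inner_smul_left, inner_zero_left,
    real_inner_self_eq_norm_sq] at hs
  have e1 : ⟪g - gradient φ x, z - x⟫ = ⟪g - gradient φ x, z - y⟫ + ⟪g - gradient φ x, y - x⟫ := by
    rw [← inner_add_right]; congr 1; abel
  have e2 : ‖y - x‖ ^ 2 = ‖z - x‖ ^ 2 - 2 * ⟪z - x, z - y⟫ + ‖z - y‖ ^ 2 := by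
    rw [← norm_sub_sq_real]; congr 2; abel
  simp only [model]
  rw [e1, e2]
  nlinarith

/-- By optimality, the model gradient at z is only the linearization residual ∇φ(z) - ∇φ(y) - L(z -
y), of norm at most 2L‖z - y‖. The decrease of the model pays for its square. -/
theorem norm_modelGrad_sq_le (hφ : Differentiable ℝ φ) (hlam : 0 < lam) (hL0 : 0 < L)
    (hL : ∀ x y, ‖gradient φ x - gradient φ y‖ ≤ L * ‖x - y‖) (x g y : Vec d) :
    ‖modelGrad φ lam x g (cgmMap φ lam L x g y)‖ ^ 2
      ≤ 8 * (L + lam) * (model φ ψ lam x g y - model φ ψ lam x g (cgmMap φ lam L x g y)) := by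
  have hm := model_cgmMap_le (ψ := ψ) hφ (by positivity) hL x g y
  have hs := cgmMap_spec (φ := φ) (by positivity : 0 < lam + L) x g y
  set z := cgmMap φ lam L x g y with hz
  have h1 : modelGrad φ lam x g z = gradient φ z - gradient φ y - L • (z - y) := by
    rw [modelGrad, ← sub_eq_zero, ← hs]; abel
  have h2 : ‖modelGrad φ lam x g z‖ ≤ 2 * L * ‖z - y‖ := by
    rw [h1]
    refine (norm_sub_le _ _).trans ?_
    rw [norm_smul, Real.norm_of_nonneg hL0.le]
    linarith [hL z y]
  have h3 : ‖modelGrad φ lam x g z‖ ^ 2 ≤ (2 * L * ‖z - y‖) ^ 2 :=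
    pow_le_pow_left₀ (norm_nonneg _) h2 2
  have h4 : 8 * (L + lam) * ((L + lam) / 2 * ‖z - y‖ ^ 2)
      ≤ 8 * (L + lam) * (model φ ψ lam x g y - model φ ψ lam x g z) :=
    mul_le_mul_of_nonneg_left (by linarith) (by positivity)
  have h5 : 0 ≤ (lam ^ 2 + 2 * L * lam) * ‖z - y‖ ^ 2 := by positivity
  nlinarith

/-- The descent lemma for ψ shows that the model majorizes φ + ψ up to the estimator error, and
still keeps the curvature lam - Δ. -/
theorem le_model (hψ : Differentiable ℝ ψ)
    (hΔ : ∀ x y, ‖gradient ψ x - gradient ψ y‖ ≤ Δ * ‖x - y‖) (x g y : Vec d) :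
    φ y + ψ y + (lam - Δ) / 2 * ‖y - x‖ ^ 2
      - ‖g - (gradient φ x + gradient ψ x)‖ * ‖y - x‖ ≤ model φ ψ lam x g y := by
  have hd := le_add_inner_add_sq_of_lipschitz_gradient hψ hΔ x y
  have hc := neg_le_of_abs_le
    (abs_real_inner_le_norm (g - (gradient φ x + gradient ψ x)) (y - x))
  have e : ⟪g - gradient φ x, y - x⟫
      = ⟪g - (gradient φ x + gradient ψ x), y - x⟫ + ⟪gradient ψ x, y - x⟫ := by
    rw [← inner_add_left]; congr 1; abel
  rw [model, e]
  nlinarith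

theorem norm_gradient_add_le (hlam : 0 ≤ lam)
    (hΔ : ∀ x y, ‖gradient ψ x - gradient ψ y‖ ≤ Δ * ‖x - y‖) (x g y : Vec d) :
    ‖gradient φ y + gradient ψ y‖ ≤ ‖modelGrad φ lam x g y‖
      + ‖g - (gradient φ x + gradient ψ x)‖ + (lam + Δ) * ‖y - x‖ := by
  have e : gradient φ y + gradient ψ y = modelGrad φ lam x g y
      - (g - (gradient φ x + gradient ψ x)) + (gradient ψ y - gradient ψ x) - lam • (y - x) := by
    rw [modelGrad]; abel
  rw [e]
  refine (norm_sub_le _ _).trans ?_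
  rw [norm_smul, Real.norm_of_nonneg hlam]
  have h1 := norm_add_le (modelGrad φ lam x g y - (g - (gradient φ x + gradient ψ x)))
    (gradient ψ y - gradient ψ x)
  have h2 := norm_sub_le (modelGrad φ lam x g y) (g - (gradient φ x + gradient ψ x))
  linarith [hΔ y x]

/-- The estimate for a single step, arranged for telescoping: on the right there are only model
values, with the coefficient 8 * (L + lam) = M / p on their difference, and the estimator error. -/
theorem potential_cgmMap_le (hφ : Differentiable ℝ φ) (hψ : Differentiable ℝ ψ) (hL0 : 0 < L)
    (hΔ0 : 0 ≤ Δ) (hM : Δ < lam) (hlam : 3 * Δ ≤ lam)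
    (hL : ∀ x y, ‖gradient φ x - gradient φ y‖ ≤ L * ‖x - y‖)
    (hΔ : ∀ x y, ‖gradient ψ x - gradient ψ y‖ ≤ Δ * ‖x - y‖)
    (x g y z : Vec d) (hz : z = cgmMap φ lam L x g y) :
    70 * (lam - Δ) * (φ z + ψ z - c) + 5 / 2 * ‖gradient φ z + gradient ψ z‖ ^ 2
        + 3 / 2 * (lam - Δ) ^ 2 * ‖z - x‖ ^ 2
      ≤ 70 * (lam - Δ) * (model φ ψ lam x g z - c)
        + 70 * (8 * (L + lam)) * (model φ ψ lam x g y - model φ ψ lam x g z)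
        + 80 * ‖g - (gradient φ x + gradient ψ x)‖ ^ 2 := by
  have hlam0 : 0 < lam := hΔ0.trans_lt hM
  have h1 := norm_modelGrad_sq_le (ψ := ψ) hφ hlam0 hL0 hL x g y
  rw [← hz] at h1
  have h2 := le_model (φ := φ) (lam := lam) hψ hΔ x g z
  have h3 := norm_gradient_add_le (φ := φ) hlam0.le hΔ x g z
  set e := ‖g - (gradient φ x + gradient ψ x)‖ with he
  set a := ‖modelGrad φ lam x g z‖ with ha
  set M := lam - Δ with hMdef
  have hMpos : 0 < M := sub_pos.2 hM
  set r := ‖z - x‖ with hr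
  set X := M * r with hX
  have hr0 : 0 ≤ r := norm_nonneg _
  have h4 : ‖gradient φ z + gradient ψ z‖ ≤ a + e + 2 * X := by
    -- This is where lam ≥ 3Δ is used: it is equivalent to lam + Δ ≤ 2(lam - Δ).
    have : (lam + Δ) * r ≤ 2 * M * r := mul_le_mul_of_nonneg_right (by linarith) hr0
    rw [hX]; linarith
  have h5 : ‖gradient φ z + gradient ψ z‖ ^ 2 ≤ (a + e + 2 * X) ^ 2 :=
    pow_le_pow_left₀ (norm_nonneg _) h4 2
  have h6 : M * (φ z + ψ z) + X ^ 2 / 2 - e * X ≤ M * model φ ψ lam x g z := by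
    have := mul_le_mul_of_nonneg_left h2 hMpos.le
    rw [hX]; nlinarith
  -- Young's inequality splits off a, giving at most 65a² + 2.6(e + 2X)² for the first term. What
  -- remains is that 23.1X² - 80.4eX + 77.4e² is positive definite.
  have h7 : 5 / 2 * (a + e + 2 * X) ^ 2 + 3 / 2 * X ^ 2
      ≤ 70 * a ^ 2 + 70 * (X ^ 2 / 2 - e * X) + 80 * e ^ 2 := by
    nlinarith [sq_nonneg (5 * a - (e + 2 * X) / 5), sq_nonneg (7 * X - 12 * e), sq_nonneg a,
      sq_nonneg X, sq_nonneg e, sq_nonneg (4 * X - 7 * e), sq_nonneg (X - 2 * e)]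
  have h8 : 3 / 2 * M ^ 2 * r ^ 2 = 3 / 2 * X ^ 2 := by rw [hX]; ring
  rw [h8]
  nlinarith

/-- The expected potential after a geometrically distributed number of composite gradient
steps, as a bound on all the partial sums over the number of steps. -/
theorem sum_geometric_potential_le (hφ : Differentiable ℝ φ) (hψ : Differentiable ℝ ψ)
    (hL0 : 0 < L) (hΔ0 : 0 ≤ Δ) (hM : Δ < lam) (hlam : 3 * Δ ≤ lam)
    (hL : ∀ x y, ‖gradient φ x - gradient φ y‖ ≤ L * ‖x - y‖)
    (hΔ : ∀ x y, ‖gradient ψ x - gradient ψ y‖ ≤ Δ * ‖x - y‖)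
    (hc : ∀ z, c ≤ φ z + ψ z) (hp : p = (lam - Δ) / (8 * (L + lam))) (x g : Vec d) (N : ℕ) :
    ∑ k ∈ Finset.range N, (1 - p) ^ k * p *
        (70 * (lam - Δ) * (φ (cgmRand lam L φ k x g) + ψ (cgmRand lam L φ k x g) - c)
          + 5 / 2 * ‖gradient φ (cgmRand lam L φ k x g)
              + gradient ψ (cgmRand lam L φ k x g)‖ ^ 2
          + 3 / 2 * (lam - Δ) ^ 2 * ‖cgmRand lam L φ k x g - x‖ ^ 2)
      ≤ 70 * (lam - Δ) * (φ x + ψ x - c)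
        + 80 * ‖g - (gradient φ x + gradient ψ x)‖ ^ 2 := by
  have hlam0 : 0 < lam := hΔ0.trans_lt hM
  set M := lam - Δ with hMdef
  have hMpos : 0 < M := sub_pos.2 hM
  have hp0 : 0 < p := by rw [hp]; positivity
  have hp1 : p ≤ 1 := by
    rw [hp, div_le_one (by positivity)]; linarith
  -- The reason for the choice of p: with weights (1 - p)^k p, the terms M·F(k+1) and (M/p)·(F(k) -
  -- F(k+1)) add up to M times a difference of (1 - p)^k F(k).
  have hpM : p * (8 * (L + lam)) = M := by
    rw [hp]; exact div_mul_cancel₀ _ (by positivity)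
  set e := ‖g - (gradient φ x + gradient ψ x)‖ with he
  set y : ℕ → Vec d := fun k => (cgmMap φ lam L x g)^[k] x with hy
  have hy0 : y 0 = x := rfl
  have hys : ∀ k, y (k + 1) = cgmMap φ lam L x g (y k) := fun k =>
    Function.iterate_succ_apply' _ _ _
  have hcg : ∀ k, cgmRand lam L φ k x g = y (k + 1) := fun k => rfl
  set F : ℕ → ℝ := fun k => model φ ψ lam x g (y k) - c with hF
  -- The minimum over r of (M/2)r² - er is -e²/(2M).
  have hlow : ∀ k, -e ^ 2 ≤ 2 * M * F k := by
    intro k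
    have h1 := le_model (φ := φ) (lam := lam) hψ hΔ x g (y k)
    have h2 := hc (y k)
    rw [← he, ← hMdef] at h1
    have h3 : M / 2 * ‖y k - x‖ ^ 2 - e * ‖y k - x‖ ≤ F k := by rw [hF]; linarith
    nlinarith [sq_nonneg (M * ‖y k - x‖ - e)]
  have hind : ∀ N : ℕ, ∑ k ∈ Finset.range N, (1 - p) ^ k * p *
        (70 * M * (φ (y (k + 1)) + ψ (y (k + 1)) - c)
          + 5 / 2 * ‖gradient φ (y (k + 1)) + gradient ψ (y (k + 1))‖ ^ 2
          + 3 / 2 * M ^ 2 * ‖y (k + 1) - x‖ ^ 2)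
      ≤ 70 * M * (F 0 - (1 - p) ^ N * F N) + 80 * e ^ 2 * (1 - (1 - p) ^ N) := by
    intro N
    induction N with
    | zero => simp
    | succ N ih =>
      rw [Finset.sum_range_succ]
      have h := potential_cgmMap_le (c := c) hφ hψ hL0 hΔ0 hM hlam hL hΔ x g (y N) _ (hys N)
      have hq : 0 ≤ (1 - p) ^ N := pow_nonneg (by linarith) _
      have h' := mul_le_mul_of_nonneg_left h (mul_nonneg hq hp0.le)
      have e1 : (1 - p) ^ N * p * (70 * M * (model φ ψ lam x g (y (N + 1)) - c)
          + 70 * (8 * (L + lam)) * (model φ ψ lam x g (y N) - model φ ψ lam x g (y (N + 1)))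
          + 80 * e ^ 2) = 70 * M * ((1 - p) ^ N * F N - (1 - p) ^ (N + 1) * F (N + 1))
            + 80 * e ^ 2 * ((1 - p) ^ N - (1 - p) ^ (N + 1)) := by
        rw [hF, ← hpM]; ring
      rw [← hMdef, ← he, e1] at h'
      linarith
  simp only [hcg]
  refine (hind N).trans ?_
  have h0 : F 0 = φ x + ψ x - c := by simp only [hF, hy0, model_self]
  rw [h0]
  -- The boundary term -70M(1 - p)^N F(N) is at most 35(1 - p)^N e², which fits into the 80(1 - p)^N
  -- e² left unused by the sum.
  have hq : 0 ≤ (1 - p) ^ N := pow_nonneg (by linarith) _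
  nlinarith [mul_le_mul_of_nonneg_left (hlow N) hq, mul_nonneg hq (sq_nonneg e)]

end CGM

/-! ### Sampling without replacement -/

/-- The average of `φ A` over the `m`-element sets `A` of clients. -/
noncomputable def sampleMean (m : ℕ) (φ : Finset (Fin n) → ℝ) : ℝ :=
  ∑ A ∈ Finset.powersetCard m Finset.univ, 1 / (n.choose m : ℝ) * φ A

theorem sampleMean_add (φ ψ : Finset (Fin n) → ℝ) :
    sampleMean m (fun A => φ A + ψ A) = sampleMean m φ + sampleMean m ψ := by
  simp only [sampleMean, mul_add, Finset.sum_add_distrib]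

theorem sampleMean_const_mul (c : ℝ) (φ : Finset (Fin n) → ℝ) :
    sampleMean m (fun A => c * φ A) = c * sampleMean m φ := by
  simp only [sampleMean, Finset.mul_sum]
  exact Finset.sum_congr rfl fun A _ => by ring

theorem sampleMean_sum {ι : Type*} (s : Finset ι) (φ : ι → Finset (Fin n) → ℝ) :
    sampleMean m (fun A => ∑ i ∈ s, φ i A) = ∑ i ∈ s, sampleMean m (φ i) := by
  simp only [sampleMean, Finset.mul_sum]
  rw [Finset.sum_comm]

theorem sampleMean_const (hmn : m ≤ n) (c : ℝ) :
    sampleMean m (fun _ : Finset (Fin n) => c) = c := by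
  have h : (0 : ℝ) < n.choose m := by exact_mod_cast Nat.choose_pos hmn
  rw [sampleMean, Finset.sum_const, Finset.card_powersetCard, Finset.card_univ, Fintype.card_fin,
    nsmul_eq_mul]
  field_simp

theorem sampleMean_congr {φ ψ : Finset (Fin n) → ℝ} (h : ∀ A, A.card = m → φ A = ψ A) :
    sampleMean m φ = sampleMean m ψ :=
  Finset.sum_congr rfl fun A hA => by rw [h A (Finset.mem_powersetCard.1 hA).2]

theorem sampleMean_subset_indicator (B : Finset (Fin n)) (hB : B.card ≤ m) :
    sampleMean m (fun A => if B ⊆ A then (1 : ℝ) else 0)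
      = ((n - B.card).choose (m - B.card) : ℝ) / n.choose m := by
  have h := Finset.card_filter_powersetCard_subset B Finset.univ m (Finset.subset_univ B) hB
  rw [Finset.card_univ, Fintype.card_fin] at h
  rw [sampleMean, ← Finset.mul_sum, Finset.sum_boole, h]
  ring

theorem sampleMean_mem (hm : 1 ≤ m) (hmn : m ≤ n) (i : Fin n) :
    sampleMean m (fun A => if i ∈ A then (1 : ℝ) else 0) = (m : ℝ) / n := by
  have h := sampleMean_subset_indicator (m := m) {i} (by simpa using hm)
  simp only [Finset.singleton_subset_iff, Finset.card_singleton] at h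
  rw [h]
  obtain ⟨k, rfl⟩ : ∃ k, m = k + 1 := ⟨m - 1, by omega⟩
  obtain ⟨l, rfl⟩ : ∃ l, n = l + 1 := ⟨n - 1, by omega⟩
  have h1 : (0 : ℝ) < (l + 1).choose (k + 1) := by exact_mod_cast Nat.choose_pos hmn
  have h2 : ((l : ℝ) + 1) * l.choose k = (l + 1).choose (k + 1) * (k + 1) := by
    exact_mod_cast Nat.add_one_mul_choose_eq l k
  rw [Nat.add_sub_cancel, Nat.add_sub_cancel]
  push_cast
  rw [div_eq_div_iff h1.ne' (by positivity)]
  linarith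

theorem sampleMean_mem_mem (hm : 1 ≤ m) (hmn : m ≤ n) {i j : Fin n}
    (hij : i ≠ j) :
    sampleMean m (fun A => if i ∈ A ∧ j ∈ A then (1 : ℝ) else 0)
      = (m : ℝ) * (m - 1) / (n * (n - 1)) := by
  have hcard : ({i, j} : Finset (Fin n)).card = 2 := Finset.card_pair hij
  have hsub : ∀ A : Finset (Fin n), ({i, j} ⊆ A) = (i ∈ A ∧ j ∈ A) := fun A => by
    simp [Finset.insert_subset_iff]
  -- For m = 1 no sample contains two clients, and the count of supersets of a pair needs m ≥ 2.
  rcases hm.eq_or_lt with h1 | h1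
  · subst h1
    rw [sampleMean_congr (ψ := fun _ => 0), sampleMean_const hmn]
    · simp
    · intro A hA
      rw [if_neg]
      rintro ⟨hi, hj⟩
      exact hij (Finset.card_le_one.1 hA.le i hi j hj)
  · have h := sampleMean_subset_indicator (m := m) {i, j} (by rw [hcard]; omega)
    simp only [hsub, hcard] at h
    rw [h]
    obtain ⟨k, rfl⟩ : ∃ k, m = k + 2 := ⟨m - 2, by omega⟩
    obtain ⟨l, rfl⟩ : ∃ l, n = l + 2 := ⟨n - 2, by omega⟩
    have h1 : (0 : ℝ) < (l + 2).choose (k + 2) := by exact_mod_cast Nat.choose_pos hmn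
    have h2 : ((l : ℝ) + 1) * l.choose k = (l + 1).choose (k + 1) * (k + 1) := by
      exact_mod_cast Nat.add_one_mul_choose_eq l k
    have h3 : ((l : ℝ) + 1 + 1) * (l + 1).choose (k + 1)
        = (l + 2).choose (k + 2) * (k + 1 + 1) := by
      exact_mod_cast Nat.add_one_mul_choose_eq (l + 1) (k + 1)
    have h4 : ((l : ℝ) + 2) * ((l + 2 : ℝ) - 1) ≠ 0 := by
      have : ((l : ℝ) + 2) * ((l + 2 : ℝ) - 1) = (l + 2) * (l + 1) := by ring
      rw [this]; positivity
    rw [Nat.add_sub_cancel, Nat.add_sub_cancel]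
    push_cast
    rw [div_eq_div_iff h1.ne' h4]
    linear_combination ((l : ℝ) + 2) * h2 + ((k : ℝ) + 1) * h3

theorem sampleMean_ite (hm : 1 ≤ m) (hmn : m ≤ n) (i : Fin n) (a b : ℝ) :
    sampleMean m (fun A => if i ∈ A then a else b) = (m : ℝ) / n * a + (1 - (m : ℝ) / n) * b := by
  have h : (fun A : Finset (Fin n) => if i ∈ A then a else b)
      = fun A => (a - b) * (if i ∈ A then 1 else 0) + b := by
    ext A; split_ifs <;> ring
  rw [h, sampleMean_add, sampleMean_const_mul, sampleMean_mem hm hmn, sampleMean_const hmn]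
  ring

/-- The mean square of a vector plus the average of a random sample of centered vectors. -/
theorem sampleMean_norm_add_mean_sq (hn : 2 ≤ n) (hm : 1 ≤ m) (hmn : m ≤ n) (a : Vec d)
    (u : Fin n → Vec d) (hu : ∑ i, u i = 0) :
    sampleMean m (fun A => ‖a + mean A u‖ ^ 2)
      = ‖a‖ ^ 2 + (((n : ℝ) - m) / (n - 1)) / m * ((n : ℝ)⁻¹ * ∑ i, ‖u i‖ ^ 2) := by
  have hm0 : (0 : ℝ) < m := by exact_mod_cast hm
  have hn0 : (0 : ℝ) < n := by exact_mod_cast (by omega : 0 < n)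
  have hn1 : (0 : ℝ) < (n : ℝ) - 1 := by
    have : (2 : ℝ) ≤ n := by exact_mod_cast hn
    linarith
  have hexp : ∀ A : Finset (Fin n), A.card = m → ‖a + mean A u‖ ^ 2
      = ‖a‖ ^ 2 + (2 * (m : ℝ)⁻¹ * ∑ i, ⟪a, u i⟫ * (if i ∈ A then 1 else 0)
        + (m : ℝ)⁻¹ ^ 2 * ∑ i, ∑ j, ⟪u i, u j⟫ * (if i ∈ A ∧ j ∈ A then 1 else 0)) := by
    intro A hA
    have h1 : ∑ i, ⟪a, u i⟫ * (if i ∈ A then 1 else 0) = ⟪a, ∑ i ∈ A, u i⟫ := by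
      simp [inner_sum]
    have h2 : ∑ i, ∑ j, ⟪u i, u j⟫ * (if i ∈ A ∧ j ∈ A then 1 else 0)
        = ‖∑ i ∈ A, u i‖ ^ 2 := by
      rw [← real_inner_self_eq_norm_sq, sum_inner]
      simp only [inner_sum, ite_and, mul_ite, mul_one, mul_zero, Finset.sum_ite_irrel,
        Finset.sum_const_zero, Finset.sum_ite_mem, Finset.univ_inter]
    rw [norm_add_sq_real, mean, hA, h1, h2, real_inner_smul_right, norm_smul, mul_pow,
      Real.norm_of_nonneg (by positivity)]
    ring
  rw [sampleMean_congr hexp, sampleMean_add, sampleMean_const hmn, sampleMean_add,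
    sampleMean_const_mul, sampleMean_const_mul, sampleMean_sum, sampleMean_sum]
  simp only [sampleMean_sum, sampleMean_const_mul, sampleMean_mem hm hmn]
  have h1 : ∑ i, ⟪a, u i⟫ * ((m : ℝ) / n) = 0 := by
    rw [← Finset.sum_mul, ← inner_sum, hu, inner_zero_right, zero_mul]
  -- The pair probability is one constant plus a correction on the diagonal. The constant part
  -- disappears because the vectors sum to zero, and the diagonal part produces q_m / m.
  have h2 : ∀ i j, ⟪u i, u j⟫ * sampleMean m (fun A => if i ∈ A ∧ j ∈ A then (1 : ℝ) else 0)
      = ⟪u i, u j⟫ * ((m : ℝ) * (m - 1) / (n * (n - 1)))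
        + if i = j then ‖u i‖ ^ 2 * ((m : ℝ) / n - (m : ℝ) * (m - 1) / (n * (n - 1))) else 0 := by
    intro i j
    split_ifs with hij
    · subst hij
      simp only [and_self, sampleMean_mem hm hmn, real_inner_self_eq_norm_sq]
      ring
    · rw [sampleMean_mem_mem hm hmn hij, add_zero]
  simp only [h2, Finset.sum_add_distrib, Finset.sum_ite_eq, Finset.mem_univ, if_true, h1,
    ← Finset.sum_mul, ← inner_sum, hu, inner_zero_right, Finset.sum_const_zero]
  field_simp
  ring

/-! ### Means over all clients -/

theorem mean_univ_eq (v : Fin n → Vec d) : mean Finset.univ v = (n : ℝ)⁻¹ • ∑ i, v i := by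
  rw [mean, Finset.card_univ, Fintype.card_fin]

theorem mean_sub (A : Finset (Fin n)) (v w : Fin n → Vec d) :
    mean A (fun i => v i - w i) = mean A v - mean A w := by
  rw [mean, Finset.sum_sub_distrib, smul_sub]; rfl

theorem mean_add (A : Finset (Fin n)) (v w : Fin n → Vec d) :
    mean A (fun i => v i + w i) = mean A v + mean A w := by
  rw [mean, Finset.sum_add_distrib, smul_add]; rfl

theorem mean_smul (A : Finset (Fin n)) (c : ℝ) (v : Fin n → Vec d) :
    mean A (fun i => c • v i) = c • mean A v := by
  rw [mean, ← Finset.smul_sum, smul_comm]; rfl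

theorem mean_const {A : Finset (Fin n)} (hA : A.card ≠ 0) (w : Vec d) :
    mean A (fun _ => w) = w := by
  have : (A.card : ℝ) ≠ 0 := by exact_mod_cast hA
  rw [mean, Finset.sum_const, ← Nat.cast_smul_eq_nsmul ℝ, inv_smul_smul₀ this]

theorem sum_sub_mean (hn : n ≠ 0) (v : Fin n → Vec d) :
    ∑ i, (v i - mean Finset.univ v) = 0 := by
  have : (n : ℝ) ≠ 0 := by exact_mod_cast hn
  rw [Finset.sum_sub_distrib, Finset.sum_const, Finset.card_univ, Fintype.card_fin, mean_univ_eq,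
    ← Nat.cast_smul_eq_nsmul ℝ, smul_inv_smul₀ this, sub_self]

theorem sum_norm_sub_mean_sq_le (hn : n ≠ 0) (v : Fin n → Vec d) (w : Vec d) :
    ∑ i, ‖v i - mean Finset.univ v‖ ^ 2 ≤ ∑ i, ‖v i - w‖ ^ 2 := by
  have h : ∀ i, ‖v i - w‖ ^ 2 = ‖v i - mean Finset.univ v‖ ^ 2
      + 2 * ⟪v i - mean Finset.univ v, mean Finset.univ v - w⟫
      + ‖mean Finset.univ v - w‖ ^ 2 := fun i => by
    rw [← norm_add_sq_real]; congr 2; abel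
  simp only [h, Finset.sum_add_distrib, ← Finset.mul_sum, ← sum_inner, sum_sub_mean hn,
    inner_zero_left, mul_zero, add_zero]
  have : 0 ≤ ∑ _i : Fin n, ‖mean Finset.univ v - w‖ ^ 2 := by positivity
  linarith

/-- The mean square of a vector plus the sampling error of the average of `v`. -/
theorem sampleMean_norm_add_mean_sub_sq_le (hn : 2 ≤ n) (hm : 1 ≤ m) (hmn : m ≤ n) (a : Vec d)
    (v : Fin n → Vec d) (w : Vec d) :
    sampleMean m (fun A => ‖a + (mean A v - mean Finset.univ v)‖ ^ 2)
      ≤ ‖a‖ ^ 2 + (((n : ℝ) - m) / (n - 1)) / m * ((n : ℝ)⁻¹ * ∑ i, ‖v i - w‖ ^ 2) := by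
  have hn1 : (0 : ℝ) ≤ (n : ℝ) - 1 := by
    have : (2 : ℝ) ≤ n := by exact_mod_cast hn
    linarith
  have hnm : (0 : ℝ) ≤ (n : ℝ) - m := sub_nonneg.2 (by exact_mod_cast hmn)
  have h : ∀ A : Finset (Fin n), A.card = m → ‖a + (mean A v - mean Finset.univ v)‖ ^ 2
      = ‖a + mean A (fun i => v i - mean Finset.univ v)‖ ^ 2 := fun A hA => by
    rw [mean_sub, mean_const (by omega)]
  rw [sampleMean_congr h,
    sampleMean_norm_add_mean_sq hn hm hmn a _ (sum_sub_mean (by omega) v)]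
  refine add_le_add le_rfl (mul_le_mul_of_nonneg_left (mul_le_mul_of_nonneg_left
    (sum_norm_sub_mean_sq_le (by omega) v w) (by positivity)) (by positivity))

/-! ### The potential function and its decrease in one iteration -/

/-- The factor `q_m / m` of the variance of sampling without replacement. -/
noncomputable def samplingFactor (n m : ℕ) : ℝ := ((n : ℝ) - m) / ((n : ℝ) - 1) / m

theorem samplingFactor_nonneg (hn : 2 ≤ n) (hmn : m ≤ n) : 0 ≤ samplingFactor n m := by
  have hn1 : (0 : ℝ) ≤ (n : ℝ) - 1 := by
    have : (2 : ℝ) ≤ n := by exact_mod_cast hn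
    linarith
  have hnm : (0 : ℝ) ≤ (n : ℝ) - m := sub_nonneg.2 (by exact_mod_cast hmn)
  rw [samplingFactor]
  positivity

theorem samplingFactor_le_one (hn : 2 ≤ n) (hm : 1 ≤ m) : samplingFactor n m ≤ 1 := by
  have hn2 : (2 : ℝ) ≤ n := by exact_mod_cast hn
  have hm1 : (1 : ℝ) ≤ m := by exact_mod_cast hm
  rw [samplingFactor, div_le_one (by linarith), div_le_iff₀ (by linarith)]
  nlinarith

/-- The SAGA points after sampling `A` at `x`: the table of gradients is `∇f_i(z_i)`. -/
def nextPoints (A : Finset (Fin n)) (x : Vec d) (z : Fin n → Vec d) : Fin n → Vec d := fun i =>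
  if i ∈ A then x else z i

/-- The RG-SAGA estimator after sampling `A`, in terms of the SAGA points. -/
noncomputable def nextEstimator (f : Fin n → Vec d → ℝ) (β : ℝ) (A : Finset (Fin n))
    (x x' g : Vec d) (z : Fin n → Vec d) : Vec d :=
  (1 - β) • g + β • (mean A (fun i => gradient (f i) x) - mean A (fun i => gradient (f i) (z i))
    + mean Finset.univ (fun i => gradient (f i) (z i)))
    + mean A (fun i => gradient (f i) x') - mean A (fun i => gradient (f i) x)

/-- The average squared deviation of the gradients of the difference functions. -/
noncomputable def devSq (f : Fin n → Vec d → ℝ) (x : Vec d) (z : Fin n → Vec d) : ℝ :=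
  (n : ℝ)⁻¹ * ∑ i, ‖gradient (diffFun f i) x - gradient (diffFun f i) (z i)‖ ^ 2

/-- The average of the squared gradient norms of the objective at the SAGA points. -/
noncomputable def pointsGradSq (f : Fin n → Vec d → ℝ) (z : Fin n → Vec d) : ℝ :=
  (n : ℝ)⁻¹ * ∑ i, ‖gradient (objective f) (z i)‖ ^ 2

/-- The potential function of I-CGM-RG-SAGA. -/
noncomputable def potential (f : Fin n → Vec d → ℝ) (m : ℕ) (M c : ℝ) (x g : Vec d)
    (z : Fin n → Vec d) : ℝ :=
  70 * M * (objective f x - c) + 4560 * ratio n m * ‖g - gradient (objective f) x‖ ^ 2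
    + 3 * samplingFactor n m * devSq f x z + 3 / 4 * pointsGradSq f z
    + 3 / 4 * ‖gradient (objective f) x‖ ^ 2

theorem devSq_nonneg (f : Fin n → Vec d → ℝ) (x : Vec d) (z : Fin n → Vec d) :
    0 ≤ devSq f x z := by rw [devSq]; positivity

theorem pointsGradSq_nonneg (f : Fin n → Vec d → ℝ) (z : Fin n → Vec d) :
    0 ≤ pointsGradSq f z := by rw [pointsGradSq]; positivity

theorem potential_nonneg (hn : 2 ≤ n) (hmn : m ≤ n) {f : Fin n → Vec d → ℝ} {M c : ℝ}
    (hM : 0 ≤ M) (hc : ∀ x, c ≤ objective f x) (x g : Vec d) (z : Fin n → Vec d) :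
    0 ≤ potential f m M c x g z := by
  have h1 := sub_nonneg.2 (hc x)
  have h2 := samplingFactor_nonneg hn hmn
  have h3 := devSq_nonneg f x z
  have h4 := pointsGradSq_nonneg f z
  have h5 : 0 ≤ ratio n m := by rw [ratio]; positivity
  rw [potential]
  positivity

theorem devSq_const_self (f : Fin n → Vec d → ℝ) (x : Vec d) : devSq f x (fun _ => x) = 0 := by
  simp [devSq]

theorem pointsGradSq_const (hn : n ≠ 0) (f : Fin n → Vec d → ℝ) (x : Vec d) :
    pointsGradSq f (fun _ => x) = ‖gradient (objective f) x‖ ^ 2 := by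
  have : (n : ℝ) ≠ 0 := by exact_mod_cast hn
  simp [pointsGradSq, this]

section OneStep

variable {f : Fin n → Vec d → ℝ} {β δ : ℝ}

theorem gradient_eq_sub_diffFun (hf : ∀ i, Differentiable ℝ (f i)) (i : Fin n) (x : Vec d) :
    gradient (f i) x = gradient (objective f) x - gradient (diffFun f i) x := by
  rw [gradient_diffFun hf, sub_sub_cancel]

/-- The new error is (1 - β)(g - ∇f(x)) plus the sampling error of v_i = β(∇f_i(x) - ∇f_i(z_i)) +
∇f_i(x') - ∇f_i(x), because SAGA and the difference correction use the same sample. The centering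
vector w is left free, since the mean minimizes the sum of squares. -/
theorem sampleMean_estimator_error_le (hf : ∀ i, Differentiable ℝ (f i)) (hn : 2 ≤ n) (hm : 1 ≤ m)
    (hmn : m ≤ n) (x x' g : Vec d) (z : Fin n → Vec d) (w : Vec d) :
    sampleMean m (fun A => ‖nextEstimator f β A x x' g z - gradient (objective f) x'‖ ^ 2)
      ≤ (1 - β) ^ 2 * ‖g - gradient (objective f) x‖ ^ 2
        + samplingFactor n m * ((n : ℝ)⁻¹ * ∑ i, ‖β • (gradient (f i) x - gradient (f i) (z i))
          + (gradient (f i) x' - gradient (f i) x) - w‖ ^ 2) := by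
  have h := sampleMean_norm_add_mean_sub_sq_le hn hm hmn
    ((1 - β) • (g - gradient (objective f) x))
    (fun i => β • (gradient (f i) x - gradient (f i) (z i))
      + (gradient (f i) x' - gradient (f i) x)) w
  rw [norm_smul, mul_pow, Real.norm_eq_abs, sq_abs] at h
  refine le_trans (le_of_eq ?_) h
  refine sampleMean_congr fun A _ => ?_
  simp only [mean_add, mean_smul, mean_sub, ← gradient_objective hf]
  rw [nextEstimator]
  congr 2
  module

theorem norm_add_three_sq_le (a b c : Vec d) :
    ‖a + b + c‖ ^ 2 ≤ 2 * ‖a‖ ^ 2 + 4 * ‖b‖ ^ 2 + 4 * ‖c‖ ^ 2 := by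
  have h := (norm_add_le (a + b) c).trans (add_le_add (norm_add_le a b) le_rfl)
  have h2 := pow_le_pow_left₀ (norm_nonneg _) h 2
  nlinarith [sq_nonneg (‖a‖ - ‖b‖ - ‖c‖), sq_nonneg (‖b‖ - ‖c‖)]

theorem devSq_const_le (hSOD : ∀ x y : Vec d,
      (1 / (n : ℝ)) * ∑ i, ‖gradient (diffFun f i) x - gradient (diffFun f i) y‖ ^ 2
        ≤ δ ^ 2 * ‖x - y‖ ^ 2) (x y : Vec d) :
    devSq f x (fun _ => y) ≤ δ ^ 2 * ‖x - y‖ ^ 2 := by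
  simpa only [devSq, one_div] using hSOD x y

theorem sampleMean_estimator_error_le' (hf : ∀ i, Differentiable ℝ (f i)) (hn : 2 ≤ n)
    (hm : 1 ≤ m) (hmn : m ≤ n) (x x' g : Vec d) (z : Fin n → Vec d) :
    sampleMean m (fun A => ‖nextEstimator f β A x x' g z - gradient (objective f) x'‖ ^ 2)
      ≤ (1 - β) ^ 2 * ‖g - gradient (objective f) x‖ ^ 2
        + samplingFactor n m * (2 * β ^ 2 * pointsGradSq f z + 4 * β ^ 2 * devSq f x z
          + 4 * devSq f x' (fun _ => x)) := by
  -- This w removes ∇f(x) and ∇f(x') from every v_i. Up to sign, what is left is β∇f(z_i) plus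
  -- differences of ∇h_i.
  refine (sampleMean_estimator_error_le hf hn hm hmn x x' g z
    (β • gradient (objective f) x + (gradient (objective f) x' - gradient (objective f) x))).trans
    (add_le_add le_rfl (mul_le_mul_of_nonneg_left ?_ (samplingFactor_nonneg hn hmn)))
  have e : 2 * β ^ 2 * pointsGradSq f z + 4 * β ^ 2 * devSq f x z + 4 * devSq f x' (fun _ => x)
      = (n : ℝ)⁻¹ * ∑ i, (2 * (β ^ 2 * ‖gradient (objective f) (z i)‖ ^ 2)
        + 4 * (β ^ 2 * ‖gradient (diffFun f i) x - gradient (diffFun f i) (z i)‖ ^ 2)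
        + 4 * ‖gradient (diffFun f i) x' - gradient (diffFun f i) x‖ ^ 2) := by
    simp only [pointsGradSq, devSq, Finset.sum_add_distrib, ← Finset.mul_sum]
    ring
  rw [e]
  refine mul_le_mul_of_nonneg_left (Finset.sum_le_sum fun i _ => ?_) (by positivity)
  have h := norm_add_three_sq_le (β • gradient (objective f) (z i))
    (β • (gradient (diffFun f i) x - gradient (diffFun f i) (z i)))
    (gradient (diffFun f i) x' - gradient (diffFun f i) x)
  rw [norm_smul, norm_smul, mul_pow, mul_pow, Real.norm_eq_abs, sq_abs] at h
  refine le_trans (le_of_eq ?_) h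
  rw [gradient_eq_sub_diffFun hf i x, gradient_eq_sub_diffFun hf i x',
    gradient_eq_sub_diffFun hf i (z i), ← norm_neg]
  congr 2
  module

/-- Young's inequality with parameter κ/2: it uses up half of the contraction 1 - κ, since (1 - κ)(1
+ κ/2) ≤ 1 - κ/2. With κ = m/n this is the refresh of one SAGA entry while the iterate moves from b
to a. -/
theorem norm_sub_sq_le_of_pos {κ : ℝ} (hκ : 0 < κ) (hκ1 : κ ≤ 1) (a b c : Vec d) :
    κ * ‖a - b‖ ^ 2 + (1 - κ) * ‖a - c‖ ^ 2
      ≤ (1 - κ / 2) * ‖b - c‖ ^ 2 + 2 / κ * ‖a - b‖ ^ 2 := by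
  have h1 := norm_add_le (a - b) (b - c)
  rw [sub_add_sub_cancel] at h1
  set s := ‖a - b‖
  set t := ‖b - c‖
  have h2 : ‖a - c‖ ^ 2 ≤ (s + t) ^ 2 := pow_le_pow_left₀ (norm_nonneg _) h1 2
  have h3 : (s + t) ^ 2 ≤ (1 + κ / 2) * t ^ 2 + (1 + 2 / κ) * s ^ 2 := by
    have h4 : 2 * s * t ≤ κ / 2 * t ^ 2 + 2 / κ * s ^ 2 := by
      have h5 : 0 ≤ (κ * t - 2 * s) ^ 2 / (2 * κ) := by positivity
      have h6 : (κ * t - 2 * s) ^ 2 / (2 * κ) = κ / 2 * t ^ 2 + 2 / κ * s ^ 2 - 2 * s * t := by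
        field_simp
        ring
      linarith
    nlinarith
  have h7 := mul_le_mul_of_nonneg_left (h2.trans h3) (sub_nonneg.2 hκ1)
  have h8 : (1 - κ) * ((1 + κ / 2) * t ^ 2 + (1 + 2 / κ) * s ^ 2)
      = (1 - κ / 2 - κ ^ 2 / 2) * t ^ 2 + (2 / κ - 1 - κ) * s ^ 2 := by
    field_simp
    ring
  nlinarith [mul_nonneg (sq_nonneg κ) (sq_nonneg t), sq_nonneg s]

theorem sampleMean_devSq_le (hm : 1 ≤ m) (hmn : m ≤ n) (x x' : Vec d) (z : Fin n → Vec d) :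
    sampleMean m (fun A => devSq f x' (nextPoints A x z))
      ≤ (1 - (m : ℝ) / n / 2) * devSq f x z
        + 2 / ((m : ℝ) / n) * devSq f x' (fun _ => x) := by
  have hm0 : (0 : ℝ) < m := by exact_mod_cast hm
  have hn0 : (0 : ℝ) < n := hm0.trans_le (by exact_mod_cast hmn)
  have hκ : 0 < (m : ℝ) / n := by positivity
  have hκ1 : (m : ℝ) / n ≤ 1 := by rw [div_le_one hn0]; exact_mod_cast hmn
  have h : ∀ A : Finset (Fin n), devSq f x' (nextPoints A x z) = (n : ℝ)⁻¹ * ∑ i,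
      if i ∈ A then ‖gradient (diffFun f i) x' - gradient (diffFun f i) x‖ ^ 2
      else ‖gradient (diffFun f i) x' - gradient (diffFun f i) (z i)‖ ^ 2 := fun A => by
    rw [devSq]
    congr 1
    refine Finset.sum_congr rfl fun i _ => ?_
    rw [nextPoints]
    split_ifs <;> rfl
  simp only [h, sampleMean_const_mul, sampleMean_sum, sampleMean_ite hm hmn]
  have e : (1 - (m : ℝ) / n / 2) * devSq f x z + 2 / ((m : ℝ) / n) * devSq f x' (fun _ => x)
      = (n : ℝ)⁻¹ * ∑ i, ((1 - (m : ℝ) / n / 2)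
          * ‖gradient (diffFun f i) x - gradient (diffFun f i) (z i)‖ ^ 2
        + 2 / ((m : ℝ) / n) * ‖gradient (diffFun f i) x' - gradient (diffFun f i) x‖ ^ 2) := by
    simp only [devSq, Finset.sum_add_distrib, ← Finset.mul_sum]
    ring
  rw [e]
  exact mul_le_mul_of_nonneg_left
    (Finset.sum_le_sum fun i _ => norm_sub_sq_le_of_pos hκ hκ1 _ _ _) (by positivity)

theorem sampleMean_pointsGradSq (hm : 1 ≤ m) (hmn : m ≤ n) (x : Vec d) (z : Fin n → Vec d) :
    sampleMean m (fun A => pointsGradSq f (nextPoints A x z))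
      = (m : ℝ) / n * ‖gradient (objective f) x‖ ^ 2
        + (1 - (m : ℝ) / n) * pointsGradSq f z := by
  have hn0 : (n : ℝ) ≠ 0 := by exact_mod_cast (by omega : n ≠ 0)
  have h : ∀ A : Finset (Fin n), pointsGradSq f (nextPoints A x z) = (n : ℝ)⁻¹ * ∑ i,
      if i ∈ A then ‖gradient (objective f) x‖ ^ 2
      else ‖gradient (objective f) (z i)‖ ^ 2 := fun A => by
    rw [pointsGradSq]
    congr 1
    refine Finset.sum_congr rfl fun i _ => ?_
    rw [nextPoints]
    split_ifs <;> rfl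
  simp only [h, sampleMean_const_mul, sampleMean_sum, sampleMean_ite hm hmn,
    Finset.sum_add_distrib, Finset.sum_const, Finset.card_univ, Fintype.card_fin, nsmul_eq_mul,
    ← Finset.mul_sum]
  rw [pointsGradSq]
  field_simp

variable {M c : ℝ}

/-- The balance of the potential. The first three terms on the right are what the local phase
controls, and the final -80‖g - ∇f(x)‖² cancels the error that this phase incurs. The weights are
such that every other loss fits into the decay of some term of the potential. -/
theorem sampleMean_potential_le (hf : ∀ i, Differentiable ℝ (f i)) (hn : 2 ≤ n) (hm : 1 ≤ m)
    (hmn : m ≤ n) (hSOD : ∀ x y : Vec d,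
      (1 / (n : ℝ)) * ∑ i, ‖gradient (diffFun f i) x - gradient (diffFun f i) y‖ ^ 2
        ≤ δ ^ 2 * ‖x - y‖ ^ 2)
    (hβ : β = 1 / (112 * ratio n m))
    (hMδ : 12769 * (ratio n m * (samplingFactor n m * δ ^ 2)) ≤ M ^ 2)
    (x x' g : Vec d) (z : Fin n → Vec d) :
    sampleMean m (fun A => potential f m M c x' (nextEstimator f β A x x' g z) (nextPoints A x z)
        + ‖gradient (objective f) x'‖ ^ 2)
      ≤ 70 * M * (objective f x' - c) + 5 / 2 * ‖gradient (objective f) x'‖ ^ 2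
        + 3 / 2 * M ^ 2 * ‖x' - x‖ ^ 2
        + (potential f m M c x g z - 70 * M * (objective f x - c)
          - 80 * ‖g - gradient (objective f) x‖ ^ 2) := by
  have hm0 : (0 : ℝ) < m := by exact_mod_cast hm
  have hn0 : (0 : ℝ) < n := hm0.trans_le (by exact_mod_cast hmn)
  have hQ0 := samplingFactor_nonneg (m := m) hn hmn
  have hQ1 := samplingFactor_le_one hn hm
  have h1 := sampleMean_estimator_error_le' (β := β) hf hn hm hmn x x' g z
  have h2 := sampleMean_devSq_le (f := f) hm hmn x x' z
  have h3 := sampleMean_pointsGradSq (f := f) hm hmn x z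
  have h4 := devSq_const_le hSOD x' x
  have hκ : (m : ℝ) / n = (ratio n m)⁻¹ := by rw [ratio, inv_div]
  have hρ1 : 1 ≤ ratio n m := by
    rw [ratio, le_div_iff₀ hm0, one_mul]; exact_mod_cast hmn
  simp only [potential, sampleMean_add, sampleMean_const_mul, sampleMean_const hmn]
  rw [hκ] at h2 h3
  rw [h3]
  set Q := samplingFactor n m
  set ρ := ratio n m
  set Ψ := pointsGradSq f z
  set Φ := devSq f x z
  set D := devSq f x' (fun _ => x)
  set E := ‖g - gradient (objective f) x‖ ^ 2
  set G := ‖gradient (objective f) x‖ ^ 2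
  have hρ0 : 0 < ρ := by linarith
  have hΨ : 0 ≤ Ψ := pointsGradSq_nonneg f z
  have hΦ : 0 ≤ Φ := devSq_nonneg f x z
  have hE : 0 ≤ E := by positivity
  have hG : 0 ≤ G := by positivity
  have hG' : 0 ≤ ‖gradient (objective f) x'‖ ^ 2 := by positivity
  have hκ1 : ρ⁻¹ ≤ 1 := inv_le_one_of_one_le₀ hρ1
  have hκ0 : 0 < ρ⁻¹ := inv_pos.2 hρ0
  have a1 := mul_le_mul_of_nonneg_left h1 (by positivity : 0 ≤ 4560 * ρ)
  have a2 := mul_le_mul_of_nonneg_left h2 (by positivity : 0 ≤ 3 * Q)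
  -- With β = 1/(112ρ): the error loses 9120/112 - 4560/12544 > 80. The coefficients 9120/12544 of Ψ
  -- and 18240/12544 of Φ stay below the available 3/4 and 3/2. Together with the 6 from `e2`, D
  -- gets 18246 ≤ (3/2)·12769.
  have e1 : 4560 * ρ * ((1 - β) ^ 2 * E + Q * (2 * β ^ 2 * Ψ + 4 * β ^ 2 * Φ + 4 * D))
      = 4560 * ρ * E - (9120 / 112 - 4560 / 12544 * ρ⁻¹) * E
        + 9120 / 12544 * (ρ⁻¹ * Q * Ψ) + 18240 / 12544 * (ρ⁻¹ * Q * Φ) + 18240 * (ρ * Q * D) := by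
    rw [hβ]; field_simp; ring
  have e2 : 3 * Q * ((1 - ρ⁻¹ / 2) * Φ + 2 / ρ⁻¹ * D)
      = 3 * Q * Φ - 3 / 2 * (ρ⁻¹ * Q * Φ) + 6 * (ρ * Q * D) := by
    field_simp
    ring
  rw [e1] at a1
  rw [e2] at a2
  have b1 : ρ * Q * D ≤ ρ * Q * (δ ^ 2 * ‖x' - x‖ ^ 2) :=
    mul_le_mul_of_nonneg_left h4 (by positivity)
  have b2 := mul_le_mul_of_nonneg_right hMδ (sq_nonneg ‖x' - x‖)
  have b3 : 0 ≤ ρ * Q * δ ^ 2 * ‖x' - x‖ ^ 2 := by positivity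
  have b4 : ρ⁻¹ * Q * Ψ ≤ ρ⁻¹ * 1 * Ψ := by gcongr
  have b5 : 0 ≤ ρ⁻¹ * Q * Φ := by positivity
  have b6 : ρ⁻¹ * G ≤ 1 * G := by gcongr
  have b7 : ρ⁻¹ * E ≤ 1 * E := by gcongr
  have b8 : 0 ≤ ρ⁻¹ * Ψ := by positivity
  linarith

/-- The expected potential and squared gradient norm after one iteration. -/
theorem sum_geometric_sampleMean_potential_le [NeZero n] {Δ L lam p : ℝ}
    (hf : ∀ i, Differentiable ℝ (f i)) (hn : 2 ≤ n) (hm : 1 ≤ m) (hmn : m ≤ n)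
    (hL0 : 0 < L) (hΔ0 : 0 ≤ Δ) (hΔlam : Δ < lam) (hlam : 3 * Δ ≤ lam)
    (hED : ∀ x y : Vec d, ‖gradient (diffFun f 0) x - gradient (diffFun f 0) y‖ ≤ Δ * ‖x - y‖)
    (hSOD : ∀ x y : Vec d,
      (1 / (n : ℝ)) * ∑ i, ‖gradient (diffFun f i) x - gradient (diffFun f i) y‖ ^ 2
        ≤ δ ^ 2 * ‖x - y‖ ^ 2)
    (hL : ∀ x y : Vec d, ‖gradient (f 0) x - gradient (f 0) y‖ ≤ L * ‖x - y‖)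
    (hc : ∀ x, c ≤ objective f x) (hβ : β = 1 / (112 * ratio n m))
    (hp : p = (lam - Δ) / (8 * (L + lam)))
    (hMδ : 12769 * (ratio n m * (samplingFactor n m * δ ^ 2)) ≤ (lam - Δ) ^ 2)
    (x g : Vec d) (z : Fin n → Vec d) (N : ℕ) :
    ∑ k ∈ Finset.range N, (1 - p) ^ k * p * sampleMean m (fun A =>
        potential f m (lam - Δ) c (cgmRand lam L (f 0) k x g)
          (nextEstimator f β A x (cgmRand lam L (f 0) k x g) g z) (nextPoints A x z)
        + ‖gradient (objective f) (cgmRand lam L (f 0) k x g)‖ ^ 2)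
      ≤ potential f m (lam - Δ) c x g z := by
  have hlam0 : 0 < lam := hΔ0.trans_lt hΔlam
  have hM : 0 < lam - Δ := sub_pos.2 hΔlam
  have hp0 : 0 < p := by rw [hp]; positivity
  have hp1 : p ≤ 1 := by
    rw [hp, div_le_one (by positivity)]; linarith
  have hfun : ∀ y, f 0 y + diffFun f 0 y = objective f y := fun y => by
    rw [diffFun]; ring
  have hgrad : ∀ y, gradient (f 0) y + gradient (diffFun f 0) y = gradient (objective f) y :=
    fun y => by rw [gradient_diffFun hf]; abel
  have hcore := sum_geometric_potential_le (c := c) (hf 0) (differentiable_diffFun hf 0) hL0 hΔ0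
    hΔlam hlam hL hED (fun y => by rw [hfun]; exact hc y) hp x g N
  simp only [hfun, hgrad] at hcore
  set C := potential f m (lam - Δ) c x g z - 70 * (lam - Δ) * (objective f x - c)
    - 80 * ‖g - gradient (objective f) x‖ ^ 2 with hC
  -- C does not depend on k. Its sign matters because a partial sum of the geometric weights is only
  -- known to be at most 1.
  have hC0 : 0 ≤ C := by
    have h2 := samplingFactor_nonneg (m := m) hn hmn
    have h3 := devSq_nonneg f x z
    have h4 := pointsGradSq_nonneg f z
    have hm0 : (0 : ℝ) < m := by exact_mod_cast hm
    have hρ1 : 1 ≤ ratio n m := by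
      rw [ratio, le_div_iff₀ hm0, one_mul]; exact_mod_cast hmn
    have h5 : 0 ≤ (4560 * ratio n m - 80) * ‖g - gradient (objective f) x‖ ^ 2 :=
      mul_nonneg (by linarith) (by positivity)
    have h6 : 0 ≤ 3 * samplingFactor n m * devSq f x z + 3 / 4 * pointsGradSq f z
      + 3 / 4 * ‖gradient (objective f) x‖ ^ 2 := by positivity
    rw [hC, potential]
    linarith
  have hq : ∀ k, 0 ≤ (1 - p) ^ k * p := fun k =>
    mul_nonneg (pow_nonneg (by linarith) _) hp0.le
  have hgeom : ∀ N : ℕ, ∑ k ∈ Finset.range N, (1 - p) ^ k * p = 1 - (1 - p) ^ N := by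
    intro N
    induction N with
    | zero => simp
    | succ N ih => rw [Finset.sum_range_succ, ih, pow_succ]; ring
  have hgeom1 : ∑ k ∈ Finset.range N, (1 - p) ^ k * p ≤ 1 := by
    rw [hgeom]
    linarith [pow_nonneg (by linarith : 0 ≤ 1 - p) N]
  calc _ ≤ ∑ k ∈ Finset.range N, (1 - p) ^ k * p *
        ((70 * (lam - Δ) * (objective f (cgmRand lam L (f 0) k x g) - c)
          + 5 / 2 * ‖gradient (objective f) (cgmRand lam L (f 0) k x g)‖ ^ 2
          + 3 / 2 * (lam - Δ) ^ 2 * ‖cgmRand lam L (f 0) k x g - x‖ ^ 2) + C) :=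
        Finset.sum_le_sum fun k _ => mul_le_mul_of_nonneg_left
          (sampleMean_potential_le hf hn hm hmn hSOD hβ hMδ x _ g z) (hq k)
    _ ≤ (70 * (lam - Δ) * (objective f x - c) + 80 * ‖g - gradient (objective f) x‖ ^ 2)
          + 1 * C := by
        simp only [mul_add _ _ C, Finset.sum_add_distrib]
        rw [← Finset.sum_mul _ _ C]
        exact add_le_add hcore (mul_le_mul_of_nonneg_right hgeom1 hC0)
    _ = potential f m (lam - Δ) c x g z := by rw [hC]; ring

/-- The expected potential and squared gradient norm after the first iteration, when the SAGA
points are reset to the new iterate. -/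
theorem sum_geometric_sampleMean_potential_reset_le [NeZero n] {Δ L lam p : ℝ}
    (hf : ∀ i, Differentiable ℝ (f i)) (hn : 2 ≤ n) (hm : 1 ≤ m) (hmn : m ≤ n)
    (hL0 : 0 < L) (hΔ0 : 0 ≤ Δ) (hΔlam : Δ < lam) (hlam : 3 * Δ ≤ lam)
    (hED : ∀ x y : Vec d, ‖gradient (diffFun f 0) x - gradient (diffFun f 0) y‖ ≤ Δ * ‖x - y‖)
    (hSOD : ∀ x y : Vec d,
      (1 / (n : ℝ)) * ∑ i, ‖gradient (diffFun f i) x - gradient (diffFun f i) y‖ ^ 2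
        ≤ δ ^ 2 * ‖x - y‖ ^ 2)
    (hL : ∀ x y : Vec d, ‖gradient (f 0) x - gradient (f 0) y‖ ≤ L * ‖x - y‖)
    (hc : ∀ x, c ≤ objective f x)
    (hp : p = (lam - Δ) / (8 * (L + lam)))
    (hMδ : 12769 * (ratio n m * (samplingFactor n m * δ ^ 2)) ≤ (lam - Δ) ^ 2)
    (x : Vec d) (N : ℕ) :
    ∑ k ∈ Finset.range N, (1 - p) ^ k * p * sampleMean m (fun A =>
        potential f m (lam - Δ) c (cgmRand lam L (f 0) k x (gradient (objective f) x))
          (nextEstimator f β A x (cgmRand lam L (f 0) k x (gradient (objective f) x))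
            (gradient (objective f) x) (fun _ => x))
          (fun _ => cgmRand lam L (f 0) k x (gradient (objective f) x))
        + ‖gradient (objective f) (cgmRand lam L (f 0) k x (gradient (objective f) x))‖ ^ 2)
      ≤ 70 * (lam - Δ) * (objective f x - c) := by
  have hlam0 : 0 < lam := hΔ0.trans_lt hΔlam
  have hM : 0 < lam - Δ := sub_pos.2 hΔlam
  have hp0 : 0 < p := by rw [hp]; positivity
  have hp1 : p ≤ 1 := by
    rw [hp, div_le_one (by positivity)]; linarith
  have hfun : ∀ y, f 0 y + diffFun f 0 y = objective f y := fun y => by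
    rw [diffFun]; ring
  have hgrad : ∀ y, gradient (f 0) y + gradient (diffFun f 0) y = gradient (objective f) y :=
    fun y => by rw [gradient_diffFun hf]; abel
  have hcore := sum_geometric_potential_le (c := c) (hf 0) (differentiable_diffFun hf 0) hL0 hΔ0
    hΔlam hlam hL hED (fun y => by rw [hfun]; exact hc y) hp x (gradient (objective f) x) N
  simp only [hfun, hgrad, sub_self, norm_zero] at hcore
  have hq : ∀ k, 0 ≤ (1 - p) ^ k * p := fun k =>
    mul_nonneg (pow_nonneg (by linarith) _) hp0.le
  refine le_trans (Finset.sum_le_sum fun k _ => mul_le_mul_of_nonneg_left ?_ (hq k))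
    (hcore.trans (le_of_eq (by ring)))
  set x' := cgmRand lam L (f 0) k x (gradient (objective f) x)
  -- All SAGA points equal x and g is exact, so β drops out, and the centering leaves only ∇h_i(x')
  -- - ∇h_i(x).
  have h1 := sampleMean_estimator_error_le (β := β) hf hn hm hmn x x' (gradient (objective f) x)
    (fun _ => x) (gradient (objective f) x' - gradient (objective f) x)
  have h2 : ∀ i, ‖β • (gradient (f i) x - gradient (f i) x) + (gradient (f i) x' - gradient (f i) x)
      - (gradient (objective f) x' - gradient (objective f) x)‖ ^ 2
      = ‖gradient (diffFun f i) x' - gradient (diffFun f i) x‖ ^ 2 := fun i => by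
    rw [gradient_eq_sub_diffFun hf i x, gradient_eq_sub_diffFun hf i x', ← norm_neg]
    congr 2
    module
  simp only [h2] at h1
  rw [sub_self, norm_zero, show (n : ℝ)⁻¹ * ∑ i, ‖gradient (diffFun f i) x'
    - gradient (diffFun f i) x‖ ^ 2 = devSq f x' (fun _ => x) from rfl] at h1
  have h3 := devSq_const_le hSOD x' x
  simp only [potential, sampleMean_add, sampleMean_const_mul, sampleMean_const hmn,
    devSq_const_self, pointsGradSq_const (by omega : n ≠ 0)]
  have hQ0 := samplingFactor_nonneg (m := m) hn hmn
  have hρ0 : 0 ≤ ratio n m := by rw [ratio]; positivity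
  have b1 := mul_le_mul_of_nonneg_left h3 (mul_nonneg hρ0 hQ0)
  have b2 := mul_le_mul_of_nonneg_right hMδ (sq_nonneg ‖x' - x‖)
  have b3 : 0 ≤ ratio n m * samplingFactor n m * δ ^ 2 * ‖x' - x‖ ^ 2 := by positivity
  have a1 := mul_le_mul_of_nonneg_left h1 hρ0
  have b4 : 0 ≤ ‖gradient (objective f) x'‖ ^ 2 := by positivity
  -- The gradient at x' is counted 3/4 + 3/4 + 1 = 5/2 times, exactly what the local phase provides.
  -- The error term needs only 4560/12769 of M²‖x' - x‖².
  nlinarith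

end OneStep

/-! ### Independent sequences of discrete random variables -/

section Sequences

variable {α : Type*} [Nonempty α]

/-- The extension of a tuple to a sequence. -/
noncomputable def extendTuple (t : ℕ) (u : Finset.range t → α) (i : ℕ) : α :=
  if h : i ∈ Finset.range t then u ⟨i, h⟩ else Classical.arbitrary α

theorem _root_.DependsOn.apply_extendTuple {β : Type*} {t : ℕ} {φ : (ℕ → α) → β}
    (hφ : DependsOn φ (Set.Iio t)) (y : ℕ → α) :
    φ (extendTuple t fun i => y i) = φ y := by
  refine hφ fun i hi => ?_
  rw [extendTuple, dif_pos (Finset.mem_range.2 hi)]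

variable [MeasurableSpace α] [Countable α] [MeasurableSingletonClass α]

/-- Such a function factors through finitely many coordinates, which take countably many values.
Hence no regularity of the gradients is needed for measurability. -/
theorem _root_.DependsOn.measurable_of_countable {β : Type*} [MeasurableSpace β] {t : ℕ}
    {φ : (ℕ → α) → β} (hφ : DependsOn φ (Set.Iio t)) : Measurable φ := by
  have h : φ = (fun u : Finset.range t → α => φ (extendTuple t u))
      ∘ fun (y : ℕ → α) (i : Finset.range t) => y i := by
    ext y
    exact (hφ.apply_extendTuple y).symm
  rw [h]
  exact (Measurable.of_discrete).comp (measurable_pi_lambda _ fun i => measurable_pi_apply _)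

variable {Ω : Type*} [MeasurableSpace Ω] {P : Measure Ω} [IsProbabilityMeasure P]

/-- Averaging over the `t`-th variable of an independent sequence, given the earlier ones. -/
theorem lintegral_eq_lintegral_tsum_of_iIndepFun {Y : ℕ → Ω → α} (hY : ∀ t, Measurable (Y t))
    (hind : iIndepFun Y P) {t : ℕ} {ψ : (ℕ → α) → α → ℝ≥0∞} (hψ : DependsOn ψ (Set.Iio t)) :
    ∫⁻ ω, ψ (fun i => Y i ω) (Y t ω) ∂P
      = ∫⁻ ω, ∑' a, ψ (fun i => Y i ω) a * P {ω' | Y t ω' = a} ∂P := by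
  set U : Ω → (Finset.range t → α) := fun ω i => Y i ω with hU
  have hUm : Measurable U := measurable_pi_lambda _ fun i => hY _
  -- The history is compressed to the finite tuple U, independent of the t-th variable. Their joint
  -- law is then a product measure on a countable space.
  have hUV : IndepFun U (Y t) P := by
    have h := hind.indepFun_finset (Finset.range t) {t}
      (Finset.disjoint_singleton_right.2 (by simp)) hY
    exact h.comp (φ := id) (ψ := fun v : ({t} : Finset ℕ) → α => v ⟨t, by simp⟩) measurable_id
      (measurable_pi_apply _)
  have hmap := (indepFun_iff_map_prod_eq_prod_map_map hUm.aemeasurable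
    (hY t).aemeasurable).1 hUV
  have he : ∀ ω, ψ (fun i => Y i ω) = ψ (extendTuple t (U ω)) := fun ω =>
    (hψ.apply_extendTuple _).symm
  simp only [he]
  have h1 := lintegral_map (μ := P)
    (f := fun q : (Finset.range t → α) × α => ψ (extendTuple t q.1) q.2)
    Measurable.of_discrete (hUm.prodMk (hY t))
  rw [← h1, hmap]
  have : IsProbabilityMeasure (P.map (Y t)) := Measure.isProbabilityMeasure_map (hY t).aemeasurable
  rw [lintegral_prod _ (Measurable.of_discrete).aemeasurable]
  simp only [lintegral_countable']
  rw [← lintegral_countable' (μ := P.map U), lintegral_map Measurable.of_discrete hUm]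
  refine lintegral_congr fun ω => tsum_congr fun a => ?_
  rw [Measure.map_apply (hY t) (measurableSet_singleton a)]
  rfl

end Sequences

section Randomness

variable {Ω : Type*} [MeasurableSpace Ω] {P : Measure Ω} {p : ℝ} {T : ℕ}
  {S : ℕ → Ω → Finset (Fin n)} {K : ℕ → Ω → ℕ} {τ : Ω → ℕ}

theorem IsRandomness.measurable_pair (h : IsRandomness P m p T S K τ) (t : ℕ) :
    Measurable fun ω => (S t ω, K t ω) :=
  (h.measurable_S t).prodMk (h.measurable_K t)

theorem IsRandomness.measure_pair (h : IsRandomness P m p T S K τ) (t : ℕ) (A : Finset (Fin n))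
    (k : ℕ) : P {ω | (S t ω, K t ω) = (A, k)} = P {ω | S t ω = A} * P {ω | K t ω = k} := by
  have := (h.indep_S_K t).measure_inter_preimage_eq_mul _ _ (measurableSet_singleton A)
    (measurableSet_singleton k)
  refine Eq.trans (congrArg P ?_) this
  ext ω
  exact Prod.mk_inj

variable [IsProbabilityMeasure P]

/-- The prescribed masses of the m-element sets already sum to one, so all other sets have
probability zero. -/
theorem IsRandomness.ae_card_eq (h : IsRandomness P m p T S K τ) (hmn : m ≤ n) (t : ℕ) :
    ∀ᵐ ω ∂P, (S t ω).card = m := by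
  have hpos : (0 : ℝ) < n.choose m := by exact_mod_cast Nat.choose_pos hmn
  have h1 := sum_measure_preimage_singleton (μ := P) (f := S t)
    (Finset.powersetCard m Finset.univ)
    (fun A _ => h.measurable_S t (measurableSet_singleton A))
  have h2 : ∑ A ∈ Finset.powersetCard m (Finset.univ : Finset (Fin n)), P (S t ⁻¹' {A}) = 1 := by
    have hlaw : ∀ A ∈ Finset.powersetCard m (Finset.univ : Finset (Fin n)),
        P (S t ⁻¹' {A}) = ENNReal.ofReal (1 / (n.choose m : ℝ)) := fun A hA =>
      h.law_S t A (Finset.mem_powersetCard.1 hA).2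
    rw [Finset.sum_congr rfl hlaw, Finset.sum_const, Finset.card_powersetCard, Finset.card_univ, Fintype.card_fin, nsmul_eq_mul,
      ← ENNReal.ofReal_natCast, ← ENNReal.ofReal_mul (by positivity), mul_one_div_cancel hpos.ne',
      ENNReal.ofReal_one]
  rw [h2] at h1
  have h3 := (prob_compl_eq_zero_iff
    (h.measurable_S t (Finset.measurableSet (Finset.powersetCard m Finset.univ)))).2 h1.symm
  filter_upwards [compl_mem_ae_iff.2 h3] with ω hω
  rw [compl_compl] at hω
  exact (Finset.mem_powersetCard.1 (show S t ω ∈ Finset.powersetCard m Finset.univ from hω)).2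

theorem IsRandomness.ae_mem_Icc (h : IsRandomness P m p T S K τ) (hT : 1 ≤ T) :
    ∀ᵐ ω ∂P, τ ω ∈ Finset.Icc 1 T := by
  have hpos : (0 : ℝ) < T := by exact_mod_cast hT
  have h1 := sum_measure_preimage_singleton (μ := P) (f := τ)
    (Finset.Icc 1 T) (fun A _ => h.measurable_τ (measurableSet_singleton A))
  have h2 : ∑ s ∈ Finset.Icc 1 T, P (τ ⁻¹' {s}) = 1 := by
    have hlaw : ∀ s ∈ Finset.Icc 1 T, P (τ ⁻¹' {s}) = ENNReal.ofReal (1 / (T : ℝ)) := h.law_τ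
    rw [Finset.sum_congr rfl hlaw, Finset.sum_const, Nat.card_Icc, Nat.add_sub_cancel, nsmul_eq_mul,
      ← ENNReal.ofReal_natCast, ← ENNReal.ofReal_mul (by positivity), mul_one_div_cancel hpos.ne',
      ENNReal.ofReal_one]
  rw [h2] at h1
  have h3 := (prob_compl_eq_zero_iff
    (h.measurable_τ (Finset.measurableSet (Finset.Icc 1 T)))).2 h1.symm
  filter_upwards [compl_mem_ae_iff.2 h3] with ω hω
  rwa [compl_compl] at hω

/-- The terms are nonnegative, so bounds on the partial sums over k suffice and summability is never
an issue. The joint law factors by the independence of S_t and K_t. -/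
theorem IsRandomness.tsum_measure_pair_le (h : IsRandomness P m p T S K τ) (hmn : m ≤ n)
    (hp0 : 0 ≤ p) (hp1 : p ≤ 1) (t : ℕ) {φ : Finset (Fin n) → ℕ → ℝ} (hφ : ∀ A k, 0 ≤ φ A k)
    {C : ℝ}
    (hC : ∀ N, ∑ k ∈ Finset.range N, (1 - p) ^ k * p * sampleMean m (fun A => φ A k) ≤ C) :
    ∑' a : Finset (Fin n) × ℕ, ENNReal.ofReal (φ a.1 a.2) * P {ω | (S t ω, K t ω) = a}
      ≤ ENNReal.ofReal C := by
  have hz : ∀ A : Finset (Fin n), A.card ≠ m → P {ω | S t ω = A} = 0 := by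
    intro A hA
    refine measure_mono_null (fun ω hω => ?_) (h.ae_card_eq hmn t)
    have hω' : S t ω = A := hω
    exact fun hc : (S t ω).card = m => hA (hω' ▸ hc)
  have hq : ∀ k, 0 ≤ (1 - p) ^ k * p := fun k => mul_nonneg (pow_nonneg (by linarith) _) hp0
  have hinner : ∀ k, ∑ A, ENNReal.ofReal (φ A k) * P {ω | S t ω = A}
      = ENNReal.ofReal (sampleMean m (fun A => φ A k)) := by
    intro k
    rw [← Finset.sum_subset (Finset.subset_univ (Finset.powersetCard m Finset.univ)), sampleMean,
      ENNReal.ofReal_sum_of_nonneg fun A _ => mul_nonneg (by positivity) (hφ A k)]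
    · refine Finset.sum_congr rfl fun A hA => ?_
      rw [h.law_S t A (Finset.mem_powersetCard.1 hA).2, ENNReal.ofReal_mul (by positivity),
        mul_comm]
    · intro A _ hA
      rw [hz A fun hc => hA (Finset.mem_powersetCard.2 ⟨Finset.subset_univ _, hc⟩), mul_zero]
  rw [ENNReal.tsum_prod', ENNReal.tsum_comm]
  refine ENNReal.tsum_le_of_sum_range_le fun N => ?_
  have hterm : ∀ k, ∑' A : Finset (Fin n),
      ENNReal.ofReal (φ A k) * P {ω | (S t ω, K t ω) = (A, k)}
      = ENNReal.ofReal ((1 - p) ^ k * p * sampleMean m (fun A => φ A k)) := by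
    intro k
    rw [tsum_fintype, ENNReal.ofReal_mul (hq k), ← hinner, Finset.mul_sum]
    refine Finset.sum_congr rfl fun A _ => ?_
    rw [h.measure_pair, h.law_K]
    ring
  rw [Finset.sum_congr rfl fun k _ => hterm k, ← ENNReal.ofReal_sum_of_nonneg]
  · exact ENNReal.ofReal_le_ofReal (hC N)
  · intro k _
    refine mul_nonneg (hq k) (Finset.sum_nonneg fun A _ => mul_nonneg (by positivity) (hφ A k))

/-- The expected value of a nonnegative function of the history and of the next pair. -/
theorem IsRandomness.lintegral_le (h : IsRandomness P m p T S K τ) (hmn : m ≤ n)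
    (hp0 : 0 ≤ p) (hp1 : p ≤ 1) (t : ℕ)
    {φ : (ℕ → Finset (Fin n) × ℕ) → Finset (Fin n) → ℕ → ℝ} (hφ : ∀ y A k, 0 ≤ φ y A k)
    (hdep : DependsOn φ (Set.Iio t)) {C : (ℕ → Finset (Fin n) × ℕ) → ℝ}
    (hC : ∀ y N, ∑ k ∈ Finset.range N, (1 - p) ^ k * p * sampleMean m (fun A => φ y A k) ≤ C y) :
    ∫⁻ ω, ENNReal.ofReal (φ (fun i => (S i ω, K i ω)) (S t ω) (K t ω)) ∂P
      ≤ ∫⁻ ω, ENNReal.ofReal (C fun i => (S i ω, K i ω)) ∂P := by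
  have h1 := lintegral_eq_lintegral_tsum_of_iIndepFun h.measurable_pair h.indep_time (t := t)
    (ψ := fun y a => ENNReal.ofReal (φ y a.1 a.2)) (fun y y' hy => by
      ext a
      exact congrArg ENNReal.ofReal (congrFun (congrFun (hdep hy) a.1) a.2))
  rw [h1]
  exact lintegral_mono fun ω => h.tsum_measure_pair_le hmn hp0 hp1 t (hφ _) (hC _)

/-- The expectation of a function of the history at the random time `τ`. -/
theorem IsRandomness.lintegral_random_time (h : IsRandomness P m p T S K τ) (hT : 1 ≤ T)
    {φ : ℕ → (ℕ → Finset (Fin n) × ℕ) → ℝ≥0∞} (hφ : ∀ s, Measurable (φ s)) :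
    ∫⁻ ω, φ (τ ω) (fun i => (S i ω, K i ω)) ∂P
      = ENNReal.ofReal (1 / (T : ℝ))
        * ∑ s ∈ Finset.Icc 1 T, ∫⁻ ω, φ s (fun i => (S i ω, K i ω)) ∂P := by
  have hYm : Measurable fun ω i => (S i ω, K i ω) := measurable_pi_lambda _ h.measurable_pair
  have h1 : ∫⁻ ω, φ (τ ω) (fun i => (S i ω, K i ω)) ∂P
      = ∫⁻ ω, ∑ s ∈ Finset.Icc 1 T, ({s} : Set ℕ).indicator 1 (τ ω)
          * φ s (fun i => (S i ω, K i ω)) ∂P := by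
    refine lintegral_congr_ae ?_
    filter_upwards [h.ae_mem_Icc hT] with ω hω
    rw [Finset.sum_eq_single_of_mem _ hω]
    · simp
    · intro s _ hs
      rw [Set.indicator_of_notMem (by simpa using hs.symm), zero_mul]
  have hind : ∀ s, Measurable fun ω => ({s} : Set ℕ).indicator (1 : ℕ → ℝ≥0∞) (τ ω) := fun s =>
    (Measurable.of_discrete (f := ({s} : Set ℕ).indicator (1 : ℕ → ℝ≥0∞))).comp h.measurable_τ
  have h2 := lintegral_finsetSum (μ := P) (Finset.Icc 1 T)
    (f := fun s ω => ({s} : Set ℕ).indicator 1 (τ ω) * φ s (fun i => (S i ω, K i ω)))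
    fun s _ => (hind s).mul ((hφ s).comp hYm)
  rw [h1, h2, Finset.mul_sum]
  refine Finset.sum_congr rfl fun s hs => ?_
  have h2 := lintegral_mul_eq_lintegral_mul_lintegral_of_indepFun (hind s) ((hφ s).comp hYm)
    (h.indep_τ.comp (Measurable.of_discrete (f := ({s} : Set ℕ).indicator (1 : ℕ → ℝ≥0∞))) (hφ s))
  simp only [Pi.mul_apply, Function.comp_apply] at h2
  rw [h2]
  congr 1
  have h3 : (fun ω => ({s} : Set ℕ).indicator (1 : ℕ → ℝ≥0∞) (τ ω))
      = (τ ⁻¹' {s}).indicator 1 := by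
    ext ω
    simp [Set.indicator]
  rw [h3, lintegral_indicator_one (h.measurable_τ (measurableSet_singleton s))]
  exact h.law_τ s hs

end Randomness

/-! ### Convergence of I-CGM-RG-SAGA -/

section Iteration

variable [NeZero n] {f : Fin n → Vec d → ℝ} {lam L β : ℝ} {x₀ : Vec d}

/-- The points whose gradients are in the SAGA table used by iteration `t`, when the table is
considered to be synchronized at the beginning of the iterations `0` and `1`. -/
noncomputable def sagaPoints (f : Fin n → Vec d → ℝ) (lam L β : ℝ) (x₀ : Vec d)
    (S : ℕ → Finset (Fin n)) (K : ℕ → ℕ) : ℕ → Fin n → Vec d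
  | 0 => fun _ => x₀
  | 1 => fun _ => iterate f lam L β x₀ S K 1
  | t + 2 => nextPoints (S (t + 1)) (iterate f lam L β x₀ S K (t + 1))
      (sagaPoints f lam L β x₀ S K (t + 1))

/-- The identity starts at index 2: the state at index 1 still holds gradients at x⁰, whereas the
points are already reset to x¹. One more step overwrites the whole table with gradients at x¹. -/
theorem iterState_b_eq (S : ℕ → Finset (Fin n)) (K : ℕ → ℕ) (t : ℕ) :
    (iterState f lam L β x₀ S K (t + 2)).b
      = fun i => gradient (f i) (sagaPoints f lam L β x₀ S K (t + 2) i) := by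
  induction t with
  | zero =>
    ext1 i
    simp [iterState, sagaTable, sagaPoints, nextPoints, iterate]
  | succ t ih =>
    ext1 i
    rw [iterState, ih]
    simp only [sagaTable, sagaPoints, nextPoints, iterate]
    rw [if_neg (by omega)]
    by_cases h : i ∈ S (t + 2) <;> simp [h]

theorem iterate_succ (S : ℕ → Finset (Fin n)) (K : ℕ → ℕ) (t : ℕ) :
    iterate f lam L β x₀ S K (t + 1) = cgmRand lam L (f 0) (K t) (iterate f lam L β x₀ S K t)
      (iterState f lam L β x₀ S K t).g := rfl

/-- For t = 0, 1 the SAGA points all coincide with the iterate, so the two sample means cancel and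
the general formula reduces to the full gradient. The exceptional iterations thus need no separate
error analysis. -/
theorem iterState_g_succ (hf : ∀ i, Differentiable ℝ (f i)) (S : ℕ → Finset (Fin n)) (K : ℕ → ℕ)
    (t : ℕ) :
    (iterState f lam L β x₀ S K (t + 1)).g = nextEstimator f β (S t)
      (iterate f lam L β x₀ S K t) (iterate f lam L β x₀ S K (t + 1))
      (iterState f lam L β x₀ S K t).g (sagaPoints f lam L β x₀ S K t) := by
  rw [iterate_succ, iterState, nextEstimator, rgUpdate, gradient_meanFun hf, gradient_meanFun hf]
  simp only [iterate]
  congr 4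
  rcases t with _ | _ | t
  · simp [sagaEstimator, sagaPoints, gradient_objective hf, iterState]
  · simp [sagaEstimator, sagaPoints, gradient_objective hf, iterate]
  · rw [sagaEstimator, if_neg (by omega), iterState_b_eq]
    congr 2
    rw [mean, mean]
    congr 1
    refine Finset.sum_congr rfl fun i hi => ?_
    rw [sagaTable, if_neg (by omega), if_pos hi]

theorem dependsOn_iterState (t : ℕ) :
    DependsOn (fun y : ℕ → Finset (Fin n) × ℕ =>
      iterState f lam L β x₀ (fun i => (y i).1) (fun i => (y i).2) t) (Set.Iio t) := by
  induction t with
  | zero => intro y y' _; rfl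
  | succ t ih =>
    intro y y' h
    have h1 := ih fun i (hi : i < t) => h i (Nat.lt_succ_of_lt hi)
    have h2 : y t = y' t := h t (Nat.lt_succ_self t)
    simp only at h1
    simp only [iterState, h1, h2]

theorem dependsOn_iterate (t : ℕ) :
    DependsOn (fun y : ℕ → Finset (Fin n) × ℕ =>
      iterate f lam L β x₀ (fun i => (y i).1) (fun i => (y i).2) t) (Set.Iio t) := fun _ _ h =>
  congrArg IterState.x (dependsOn_iterState t h)

theorem dependsOn_sagaPoints (t : ℕ) :
    DependsOn (fun y : ℕ → Finset (Fin n) × ℕ =>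
      sagaPoints f lam L β x₀ (fun i => (y i).1) (fun i => (y i).2) t) (Set.Iio t) := by
  induction t with
  | zero => intro y y' _; rfl
  | succ t ih =>
    intro y y' h
    rcases t with _ | t
    · simp only [sagaPoints]
      exact funext fun _ => dependsOn_iterate 1 h
    · have h1 := ih fun i (hi : i < t + 1) => h i (Nat.lt_succ_of_lt hi)
      have h2 : y (t + 1) = y' (t + 1) := h (t + 1) (Nat.lt_succ_self _)
      have h3 := dependsOn_iterate (f := f) (lam := lam) (L := L) (β := β) (x₀ := x₀) (t + 1)
        fun i (hi : i < t + 1) => h i (Nat.lt_succ_of_lt hi)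
      simp only at h1 h3
      simp only [sagaPoints, h1, h2, h3]

/-- The potential at the beginning of iteration `t`. -/
noncomputable def potentialAt (f : Fin n → Vec d → ℝ) (lam L β : ℝ) (x₀ : Vec d) (m : ℕ) (M c : ℝ)
    (t : ℕ) (y : ℕ → Finset (Fin n) × ℕ) : ℝ :=
  potential f m M c (iterate f lam L β x₀ (fun i => (y i).1) (fun i => (y i).2) t)
    (iterState f lam L β x₀ (fun i => (y i).1) (fun i => (y i).2) t).g
    (sagaPoints f lam L β x₀ (fun i => (y i).1) (fun i => (y i).2) t)

/-- The squared gradient norm of the objective at the iterate `x^t`. -/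
noncomputable def gradSqAt (f : Fin n → Vec d → ℝ) (lam L β : ℝ) (x₀ : Vec d)
    (t : ℕ) (y : ℕ → Finset (Fin n) × ℕ) : ℝ :=
  ‖gradient (objective f) (iterate f lam L β x₀ (fun i => (y i).1) (fun i => (y i).2) t)‖ ^ 2

theorem measurable_gradSqAt (t : ℕ) :
    Measurable fun y => ENNReal.ofReal (gradSqAt f lam L β x₀ t y) :=
  DependsOn.measurable_of_countable (t := t) fun _ _ h =>
    congrArg (fun x => ENNReal.ofReal (‖gradient (objective f) x‖ ^ 2)) (dependsOn_iterate t h)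

variable {Δ δ c p : ℝ} {Ω : Type*} [MeasurableSpace Ω] {P : Measure Ω} [IsProbabilityMeasure P]
  {T : ℕ} {S : ℕ → Ω → Finset (Fin n)} {K : ℕ → Ω → ℕ} {τ : Ω → ℕ}

/-- The expected potentials telescope from t = 1 on. All expectations are integrals in [0, ∞], and
splitting off the squared gradient norm requires measurability of that term only. -/
theorem sum_lintegral_gradSqAt_le
    (hf : ∀ i, Differentiable ℝ (f i)) (hn : 2 ≤ n) (hm : 1 ≤ m) (hmn : m ≤ n)
    (hL0 : 0 < L) (hΔ0 : 0 ≤ Δ) (hΔlam : Δ < lam) (hlam : 3 * Δ ≤ lam)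
    (hED : ∀ x y : Vec d, ‖gradient (diffFun f 0) x - gradient (diffFun f 0) y‖ ≤ Δ * ‖x - y‖)
    (hSOD : ∀ x y : Vec d,
      (1 / (n : ℝ)) * ∑ i, ‖gradient (diffFun f i) x - gradient (diffFun f i) y‖ ^ 2
        ≤ δ ^ 2 * ‖x - y‖ ^ 2)
    (hL : ∀ x y : Vec d, ‖gradient (f 0) x - gradient (f 0) y‖ ≤ L * ‖x - y‖)
    (hc : ∀ x, c ≤ objective f x) (hβ : β = 1 / (112 * ratio n m))
    (hp : p = (lam - Δ) / (8 * (L + lam)))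
    (hMδ : 12769 * (ratio n m * (samplingFactor n m * δ ^ 2)) ≤ (lam - Δ) ^ 2)
    (h : IsRandomness P m p T S K τ) (t : ℕ) :
    ∑ s ∈ Finset.Icc 1 t, ∫⁻ ω, ENNReal.ofReal
        (gradSqAt f lam L β x₀ s fun i => (S i ω, K i ω)) ∂P
      ≤ ENNReal.ofReal (70 * (lam - Δ) * (objective f x₀ - c)) := by
  have hlam0 : 0 < lam := hΔ0.trans_lt hΔlam
  have hM : 0 < lam - Δ := sub_pos.2 hΔlam
  have hp0 : 0 ≤ p := by rw [hp]; positivity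
  have hp1 : p ≤ 1 := by
    rw [hp, div_le_one (by positivity)]; linarith
  have hYm : Measurable fun ω i => (S i ω, K i ω) := measurable_pi_lambda _ h.measurable_pair
  have hsplit : ∀ s, ∫⁻ ω, ENNReal.ofReal (potentialAt f lam L β x₀ m (lam - Δ) c s
        (fun i => (S i ω, K i ω)) + gradSqAt f lam L β x₀ s fun i => (S i ω, K i ω)) ∂P
      = ∫⁻ ω, ENNReal.ofReal (potentialAt f lam L β x₀ m (lam - Δ) c s
        fun i => (S i ω, K i ω)) ∂P
        + ∫⁻ ω, ENNReal.ofReal (gradSqAt f lam L β x₀ s fun i => (S i ω, K i ω)) ∂P := by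
    intro s
    have hmeas : Measurable fun ω =>
        ENNReal.ofReal (gradSqAt f lam L β x₀ s fun i => (S i ω, K i ω)) :=
      (measurable_gradSqAt s).comp hYm
    rw [← lintegral_add_right _ hmeas]
    refine lintegral_congr fun ω => ?_
    exact ENNReal.ofReal_add (potential_nonneg hn hmn hM.le hc _ _ _) (sq_nonneg _)
  have hnn : ∀ x g z x', 0 ≤ potential f m (lam - Δ) c x g z + ‖gradient (objective f) x'‖ ^ 2 :=
    fun x g z x' => add_nonneg (potential_nonneg hn hmn hM.le hc _ _ _) (sq_nonneg _)
  have hstep : ∀ s, ∫⁻ ω, ENNReal.ofReal (potentialAt f lam L β x₀ m (lam - Δ) c (s + 2)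
        (fun i => (S i ω, K i ω)) + gradSqAt f lam L β x₀ (s + 2) fun i => (S i ω, K i ω)) ∂P
      ≤ ∫⁻ ω, ENNReal.ofReal (potentialAt f lam L β x₀ m (lam - Δ) c (s + 1)
        fun i => (S i ω, K i ω)) ∂P := by
    intro s
    have h1 := h.lintegral_le hmn hp0 hp1 (s + 1)
      (φ := fun y A k =>
        (fun (a : IterState n d) (z : Fin n → Vec d) => potential f m (lam - Δ) c
            (cgmRand lam L (f 0) k a.x a.g)
          (nextEstimator f β A a.x (cgmRand lam L (f 0) k a.x a.g) a.g z) (nextPoints A a.x z)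
        + ‖gradient (objective f) (cgmRand lam L (f 0) k a.x a.g)‖ ^ 2)
        (iterState f lam L β x₀ (fun i => (y i).1) (fun i => (y i).2) (s + 1))
        (sagaPoints f lam L β x₀ (fun i => (y i).1) (fun i => (y i).2) (s + 1)))
      (C := potentialAt f lam L β x₀ m (lam - Δ) c (s + 1))
      (fun y A k => hnn _ _ _ _)
      (fun y y' hy => by
        have e1 := dependsOn_iterState (f := f) (lam := lam) (L := L) (β := β) (x₀ := x₀) _ hy
        have e2 := dependsOn_sagaPoints (f := f) (lam := lam) (L := L) (β := β) (x₀ := x₀) _ hy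
        simp only at e1 e2
        simp only [e1, e2])
      (fun y N => sum_geometric_sampleMean_potential_le hf hn hm hmn hL0 hΔ0 hΔlam hlam hED hSOD hL
        hc hβ hp hMδ _ _ _ N)
    refine le_trans (le_of_eq (lintegral_congr fun ω => ?_)) h1
    rw [potentialAt, gradSqAt, iterState_g_succ hf]
    rfl
  -- The first iteration starts with exact g and ends with the points reset to x¹. It is bounded by
  -- the initial function gap alone instead of by the full potential at x⁰.
  have hfirst : ∫⁻ ω, ENNReal.ofReal (potentialAt f lam L β x₀ m (lam - Δ) c 1
        (fun i => (S i ω, K i ω)) + gradSqAt f lam L β x₀ 1 fun i => (S i ω, K i ω)) ∂P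
      ≤ ENNReal.ofReal (70 * (lam - Δ) * (objective f x₀ - c)) := by
    have h1 := h.lintegral_le hmn hp0 hp1 0
      (φ := fun _ A k => potential f m (lam - Δ) c
          (cgmRand lam L (f 0) k x₀ (gradient (objective f) x₀))
          (nextEstimator f β A x₀ (cgmRand lam L (f 0) k x₀ (gradient (objective f) x₀))
            (gradient (objective f) x₀) (fun _ => x₀))
          (fun _ => cgmRand lam L (f 0) k x₀ (gradient (objective f) x₀))
        + ‖gradient (objective f) (cgmRand lam L (f 0) k x₀ (gradient (objective f) x₀))‖ ^ 2)
      (C := fun _ => 70 * (lam - Δ) * (objective f x₀ - c))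
      (fun y A k => hnn _ _ _ _) (fun y y' _ => rfl)
      (fun y N => sum_geometric_sampleMean_potential_reset_le hf hn hm hmn hL0 hΔ0 hΔlam hlam hED
        hSOD hL hc hp hMδ _ N)
    rw [lintegral_const, measure_univ, mul_one] at h1
    refine le_trans (le_of_eq (lintegral_congr fun ω => ?_)) h1
    rw [potentialAt, gradSqAt, iterState_g_succ hf]
    rfl
  rcases t with _ | t
  · simp
  have hall : ∀ t, ∫⁻ ω, ENNReal.ofReal (potentialAt f lam L β x₀ m (lam - Δ) c (t + 1)
        fun i => (S i ω, K i ω)) ∂P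
      + ∑ s ∈ Finset.Icc 1 (t + 1), ∫⁻ ω, ENNReal.ofReal
        (gradSqAt f lam L β x₀ s fun i => (S i ω, K i ω)) ∂P
      ≤ ENNReal.ofReal (70 * (lam - Δ) * (objective f x₀ - c)) := by
    intro t
    induction t with
    | zero =>
      rw [zero_add, Finset.Icc_self, Finset.sum_singleton, ← hsplit]
      exact hfirst
    | succ t ih =>
      rw [Finset.sum_Icc_succ_top (by omega), add_comm (∑ s ∈ _, _), ← add_assoc, ← hsplit]
      exact (add_le_add (hstep t) le_rfl).trans ih
  exact le_add_self.trans (hall t)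

/-- The expected squared gradient norm of the objective at a uniformly chosen iterate. -/
theorem lintegral_gradSq_random_iterate_le
    (hf : ∀ i, Differentiable ℝ (f i)) (hn : 2 ≤ n) (hm : 1 ≤ m) (hmn : m ≤ n)
    (hL0 : 0 < L) (hΔ0 : 0 ≤ Δ) (hΔlam : Δ < lam) (hlam : 3 * Δ ≤ lam)
    (hED : ∀ x y : Vec d, ‖gradient (diffFun f 0) x - gradient (diffFun f 0) y‖ ≤ Δ * ‖x - y‖)
    (hSOD : ∀ x y : Vec d,
      (1 / (n : ℝ)) * ∑ i, ‖gradient (diffFun f i) x - gradient (diffFun f i) y‖ ^ 2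
        ≤ δ ^ 2 * ‖x - y‖ ^ 2)
    (hL : ∀ x y : Vec d, ‖gradient (f 0) x - gradient (f 0) y‖ ≤ L * ‖x - y‖)
    (hc : ∀ x, c ≤ objective f x) (hβ : β = 1 / (112 * ratio n m))
    (hp : p = (lam - Δ) / (8 * (L + lam)))
    (hMδ : 12769 * (ratio n m * (samplingFactor n m * δ ^ 2)) ≤ (lam - Δ) ^ 2)
    (h : IsRandomness P m p T S K τ) (hT : 1 ≤ T) :
    ∫⁻ ω, ENNReal.ofReal (‖gradient (objective f) (iterate f lam L β x₀ (fun t => S t ω)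
        (fun t => K t ω) (τ ω))‖ ^ 2) ∂P
      ≤ ENNReal.ofReal (70 * (lam - Δ) * (objective f x₀ - c) / T) := by
  have hT0 : (0 : ℝ) < T := by exact_mod_cast hT
  have h1 := h.lintegral_random_time hT
    (measurable_gradSqAt (f := f) (lam := lam) (L := L) (β := β) (x₀ := x₀))
  have h2 := sum_lintegral_gradSqAt_le (x₀ := x₀) hf hn hm hmn hL0 hΔ0 hΔlam hlam hED hSOD hL hc hβ
    hp hMδ h T
  refine (le_of_eq h1).trans ((mul_le_mul_right h2 _).trans (le_of_eq ?_))
  rw [← ENNReal.ofReal_mul (by positivity)]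
  congr 1
  ring

end Iteration

/-! ### The run of I-CGM-RG-SAGA as a federated algorithm -/

theorem result_localCGM (lam L : ℝ) (φ : Vec d → ℝ) (x g h : Vec d) (k : ℕ) (y : Vec d) :
    (localCGM lam L x g (gradient φ x) h k y).result (firstOrderOracle φ)
      = (h, ((cgmMap φ lam L x g)^[k] y, 0)) := by
  induction k generalizing y with
  | zero => rfl
  | succ k ih => exact ih _

theorem numQueries_localCGM (lam L : ℝ) (O : Vec d → ℝ × Vec d) (x g gx h : Vec d) (k : ℕ)
    (y : Vec d) : (localCGM lam L x g gx h k y).numQueries O = k := by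
  induction k generalizing y with
  | zero => rfl
  | succ k ih => exact congrArg (· + 1) (ih _)

theorem result_localCGMRand (lam L : ℝ) (φ : Vec d → ℝ) (k : ℕ) (x g h : Vec d) :
    (localCGMRand lam L k x g h).result (firstOrderOracle φ) = (h, (cgmRand lam L φ k x g, 0)) :=
  result_localCGM lam L φ x g h k _

theorem numQueries_localCGMRand (lam L : ℝ) (O : Vec d → ℝ × Vec d) (k : ℕ) (x g h : Vec d) :
    (localCGMRand lam L k x g h).numQueries O = k + 1 :=
  congrArg (· + 1) (numQueries_localCGM lam L O x g _ h k _)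

/-- Client i lies in block i / m. If this is the shifted last block, then n - m ≤ i still holds. -/
theorem exists_mem_block (hm : 1 ≤ m) (i : Fin n) : ∃ j < ⌈ratio n m⌉₊, i ∈ block n m j := by
  have hi := i.isLt
  refine ⟨i / m, ?_, ?_⟩
  · rw [Nat.lt_ceil, ratio, lt_div_iff₀ (by exact_mod_cast hm)]
    exact_mod_cast (Nat.div_mul_le_self _ _).trans_lt hi
  · have h1 := Nat.div_mul_le_self (i : ℕ) m
    have h2 := Nat.lt_div_mul_add (a := (i : ℕ)) hm
    simp only [block, Finset.mem_filter, Finset.mem_univ, true_and]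
    omega

theorem mean_congr {A : Finset (Fin n)} {v w : Fin n → Vec d} (h : ∀ i ∈ A, v i = w i) :
    mean A v = mean A w := by
  rw [mean, mean, Finset.sum_congr rfl h]

/-- The SAGA table at the beginning of iteration `t`, after a possible synchronization. -/
noncomputable def syncTable (f : Fin n → Vec d → ℝ) (t : ℕ) (s : IterState n d) : Fin n → Vec d :=
  if t ≤ 1 then fun i => gradient (f i) s.x else s.b

theorem sagaTable_eq_syncTable (f : Fin n → Vec d → ℝ) (t : ℕ) (s : IterState n d)
    (A : Finset (Fin n)) : sagaTable f t s.x A s.b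
      = fun i => if i ∈ A then gradient (f i) s.x else syncTable f t s i := by
  funext i
  rw [sagaTable, syncTable]
  split_ifs <;> rfl

theorem sagaEstimator_eq_syncTable {f : Fin n → Vec d → ℝ} (hf : ∀ i, Differentiable ℝ (f i))
    (t : ℕ) (s : IterState n d) (A : Finset (Fin n)) : sagaEstimator f t s.x A s.b
      = mean A (fun i => gradient (f i) s.x - syncTable f t s i)
        + mean Finset.univ (syncTable f t s) := by
  rw [sagaEstimator, syncTable]
  split_ifs with ht
  · simp [gradient_objective hf, mean]
  · rw [mean_sub]
    congr 2
    refine mean_congr fun i hi => ?_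
    rw [sagaTable, if_neg ht, if_pos hi]

/-- The server needs only the average of the stored vectors, and the responses of the sampled
clients suffice to update it. -/
theorem mean_univ_sagaTable (f : Fin n → Vec d → ℝ) (t : ℕ) (s : IterState n d)
    (A : Finset (Fin n)) : mean Finset.univ (sagaTable f t s.x A s.b)
      = mean Finset.univ (syncTable f t s)
        + (n : ℝ)⁻¹ • ∑ i ∈ A, (gradient (f i) s.x - syncTable f t s i) := by
  rw [sagaTable_eq_syncTable, mean_univ_eq, mean_univ_eq, ← smul_add]
  congr 1
  have h : ∑ i ∈ A, (gradient (f i) s.x - syncTable f t s i)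
      = ∑ i, if i ∈ A then gradient (f i) s.x - syncTable f t s i else 0 := by simp
  rw [h, ← Finset.sum_add_distrib]
  refine Finset.sum_congr rfl fun i _ => ?_
  split_ifs <;> simp

section Run

variable [NeZero n]

/-- Induction over the blocks, the highest one being written first. Overlaps are harmless because
every write for client i has the same value. Each round costs at most one query. -/
theorem run_fullSync (O : Fin n → Vec d → ℝ × Vec d) (S : ℕ → Finset (Fin n)) (hmn : m ≤ n)
    (x : Vec d) (next : (Fin n → Vec d) → Algorithm n m d (Vec d) (Vec d × Vec d)) (r j : ℕ)
    (table h : Fin n → Vec d) :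
    ∃ l ≤ j, ∃ table' h' : Fin n → Vec d,
      (∀ i, (∃ j' < j, i ∈ block n m j') → table' i = (O i x).2 ∧ h' i = (O i x).2) ∧
      (∀ i, (¬ ∃ j' < j, i ∈ block n m j') → table' i = table i ∧ h' i = h i) ∧
      (fullSync hmn x j table next).run O S r h
        = ⟨((next table').run O S r h').output, ((next table').run O S r h').numA + j,
          ((next table').run O S r h').numR, ((next table').run O S r h').numD,
          ((next table').run O S r h').localSteps + l⟩ := by
  induction j generalizing table h with
  | zero => exact ⟨0, le_rfl, table, h, by simp, by simp, rfl⟩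
  | succ j ih =>
    set resp : Fin n → Option (Vec d × Vec d) := fun i =>
      if i ∈ block n m j then some ((O i x).2, 0) else none with hresp
    set table₁ : Fin n → Vec d := fun i => match resp i with
      | some v => v.1
      | none => table i with htable
    set h₁ : Fin n → Vec d := fun i => if i ∈ block n m j then (O i x).2 else h i with hh₁
    obtain ⟨l, hl, table', h', hin, hout, hrun⟩ := ih table₁ h₁
    set q := (block n m j).sup (fun i => (LocalMethod.query x
      (fun o => .done (o.2, (o.2, (0 : Vec d))))).numQueries (O i)) with hq
    have hq1 : q ≤ 1 := Finset.sup_le fun i _ => le_rfl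
    have hlast : ∀ i, i ∈ block n m j → table₁ i = (O i x).2 ∧ h₁ i = (O i x).2 := fun i hi => by
      simp [htable, hresp, hh₁, hi]
    have hnot : ∀ i, i ∉ block n m j → table₁ i = table i ∧ h₁ i = h i := fun i hi => by
      simp [htable, hresp, hh₁, hi]
    refine ⟨l + q, by omega, table', h', ?_, ?_, ?_⟩
    · rintro i ⟨j', hj', hi⟩
      by_cases hex : ∃ j' < j, i ∈ block n m j'
      · exact hin i hex
      · have : j' = j := by
          by_contra hne
          exact hex ⟨j', by omega, hi⟩
        subst this
        rw [(hout i hex).1, (hout i hex).2]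
        exact hlast i hi
    · intro i hi
      have hex : ¬ ∃ j' < j, i ∈ block n m j' := fun ⟨j', hj', hi'⟩ => hi ⟨j', by omega, hi'⟩
      rw [(hout i hex).1, (hout i hex).2]
      exact hnot i fun hc => hi ⟨j, by omega, hc⟩
    · have hrun' : (fullSync hmn x (j + 1) table next).run O S r h
          = ⟨((fullSync hmn x j table₁ next).run O S r h₁).output,
            ((fullSync hmn x j table₁ next).run O S r h₁).numA + 1,
            ((fullSync hmn x j table₁ next).run O S r h₁).numR,
            ((fullSync hmn x j table₁ next).run O S r h₁).numD,
            ((fullSync hmn x j table₁ next).run O S r h₁).localSteps + q⟩ := rfl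
      rw [hrun', hrun]
      simp only [Outcome.mk.injEq, true_and]
      omega

theorem run_fullSync_all (hm : 1 ≤ m) (O : Fin n → Vec d → ℝ × Vec d) (S : ℕ → Finset (Fin n))
    (hmn : m ≤ n) (x : Vec d)
    (next : (Fin n → Vec d) → Algorithm n m d (Vec d) (Vec d × Vec d)) (r : ℕ)
    (table h : Fin n → Vec d) :
    ∃ l ≤ ⌈ratio n m⌉₊, (fullSync hmn x ⌈ratio n m⌉₊ table next).run O S r h
      = ⟨((next fun i => (O i x).2).run O S r fun i => (O i x).2).output,
        ((next fun i => (O i x).2).run O S r fun i => (O i x).2).numA + ⌈ratio n m⌉₊,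
        ((next fun i => (O i x).2).run O S r fun i => (O i x).2).numR,
        ((next fun i => (O i x).2).run O S r fun i => (O i x).2).numD,
        ((next fun i => (O i x).2).run O S r fun i => (O i x).2).localSteps + l⟩ := by
  obtain ⟨l, hl, table', h', hin, -, hrun⟩ := run_fullSync O S hmn x next r ⌈ratio n m⌉₊ table h
  have h1 : table' = fun i => (O i x).2 := funext fun i => (hin i (exists_mem_block hm i)).1
  have h2 : h' = fun i => (O i x).2 := funext fun i => (hin i (exists_mem_block hm i)).2
  subst h1 h2
  exact ⟨l, hl, hrun⟩

/-- A delegate round that returns the stored vector unchanged leaves all client information as it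
was, and its cost is that of client 0. -/
theorem run_delegate {H R : Type} (O : Fin n → Vec d → ℝ × Vec d) (S : ℕ → Finset (Fin n))
    (method : Fin n → H → LocalMethod d (H × R))
    (next : Finset (Fin n) → (Fin n → Option R) → Algorithm n m d H R) (r : ℕ) (h : Fin n → H)
    (hres : ∀ i ∈ ({0} : Finset (Fin n)), ((method i (h i)).result (O i)).1 = h i)
    (out : Outcome d) (hout : out = (next {0} (fun i => if i ∈ ({0} : Finset (Fin n)) then
      some ((method i (h i)).result (O i)).2 else none)).run O S r h) :
    (Algorithm.round .delegate method next).run O S r h = ⟨out.output, out.numA, out.numR,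
      out.numD + 1, out.localSteps + (method 0 (h 0)).numQueries (O 0)⟩ := by
  have hh : (fun i => if i ∈ ({0} : Finset (Fin n)) then
      ((method i (h i)).result (O i)).1 else h i) = h := by
    funext i
    split_ifs with hi
    · exact hres i hi
    · rfl
  have hout' : out = (next {0} (fun i => if i ∈ ({0} : Finset (Fin n)) then
      some ((method i (h i)).result (O i)).2 else none)).run O S r
      (fun i => if i ∈ ({0} : Finset (Fin n)) then
        ((method i (h i)).result (O i)).1 else h i) := by
    rw [hh]
    exact hout
  rw [← Finset.sup_singleton (f := fun i => (method i (h i)).numQueries (O i)) (b := 0)]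
  subst hout'
  rfl

/-- The delegate makes k + 1 queries and each sampled client makes two, whence k + 3. -/
theorem run_mainRounds (f : Fin n → Vec d → ℝ) (S : ℕ → Finset (Fin n)) (lam L β : ℝ) (k : ℕ)
    (x g b : Vec d)
    (next : Vec d → Vec d → Vec d → Algorithm n m d (Vec d) (Vec d × Vec d)) (r : ℕ)
    (h : Fin n → Vec d) :
    ∃ l ≤ k + 3, ∃ out : Outcome d,
      out = (next (cgmRand lam L (f 0) k x g)
        ((1 - β) • g + β • (mean (S r) (fun i => gradient (f i) x - h i) + b)
          + mean (S r) (fun i =>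
            gradient (f i) (cgmRand lam L (f 0) k x g) - gradient (f i) x))
        (b + (n : ℝ)⁻¹ • ∑ i ∈ S r, (gradient (f i) x - h i))).run
          (fun i => firstOrderOracle (f i)) S (r + 1)
          (fun i => if i ∈ S r then gradient (f i) x else h i) ∧
      (mainRounds lam L β k x g b next).run (fun i => firstOrderOracle (f i)) S r h
        = ⟨out.output, out.numA, out.numR + 1, out.numD + 1, out.localSteps + l⟩ := by
  set x' := cgmRand lam L (f 0) k x g with hx'
  set u : Fin n → Vec d := fun i =>
    (((if i ∈ S r then some ((localDiff x x' (h i)).result (firstOrderOracle (f i))).2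
      else none) : Option (Vec d × Vec d)).getD (0, 0)).1 with hu
  set v : Fin n → Vec d := fun i =>
    (((if i ∈ S r then some ((localDiff x x' (h i)).result (firstOrderOracle (f i))).2
      else none) : Option (Vec d × Vec d)).getD (0, 0)).2 with hv
  have hu' : ∀ i ∈ S r, u i = gradient (f i) x' - gradient (f i) x := fun i hi => by
    rw [hu]; simp only [hi, if_true]; rfl
  have hv' : ∀ i ∈ S r, v i = gradient (f i) x - h i := fun i hi => by
    rw [hv]; simp only [hi, if_true]; rfl
  have hx : ((if (0 : Fin n) ∈ ({0} : Finset (Fin n)) then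
      some ((localCGMRand lam L k x g (h 0)).result (firstOrderOracle (f 0))).2
      else none : Option (Vec d × Vec d)).getD (0, 0)).1 = x' := by
    rw [if_pos (Finset.mem_singleton_self _), result_localCGMRand]
    rfl
  set q := (S r).sup (fun i => (localDiff x x' (h i)).numQueries (firstOrderOracle (f i))) with hq
  have hq2 : q ≤ 2 := Finset.sup_le fun i _ => le_rfl
  refine ⟨q + (k + 1), by omega, _, rfl, ?_⟩
  rw [← mean_congr hu', ← mean_congr hv', ← Finset.sum_congr rfl hv']
  rw [mainRounds]
  refine (run_delegate (fun i => firstOrderOracle (f i)) S _ _ r h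
    (fun i _ => by rw [result_localCGMRand]) _ rfl).trans ?_
  dsimp only
  rw [hx, numQueries_localCGMRand, ← add_assoc (Outcome.localSteps _) q (k + 1)]
  rfl

/-- The run of one iteration, from the synchronized table on. -/
theorem run_mainRounds_iterState {f : Fin n → Vec d → ℝ} (hf : ∀ i, Differentiable ℝ (f i))
    (lam L β : ℝ) (x₀ : Vec d) (S : ℕ → Finset (Fin n)) (K : ℕ → ℕ) (t : ℕ)
    (next : Vec d → Vec d → Vec d → Algorithm n m d (Vec d) (Vec d × Vec d)) :
    ∃ l ≤ K t + 3, ∃ out : Outcome d,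
      out = (next (iterState f lam L β x₀ S K (t + 1)).x (iterState f lam L β x₀ S K (t + 1)).g
        (mean Finset.univ (iterState f lam L β x₀ S K (t + 1)).b)).run
          (fun i => firstOrderOracle (f i)) S (t + 1) (iterState f lam L β x₀ S K (t + 1)).b ∧
      (mainRounds lam L β (K t) (iterState f lam L β x₀ S K t).x (iterState f lam L β x₀ S K t).g
        (mean Finset.univ (syncTable f t (iterState f lam L β x₀ S K t))) next).run
          (fun i => firstOrderOracle (f i)) S t (syncTable f t (iterState f lam L β x₀ S K t))
        = ⟨out.output, out.numA, out.numR + 1, out.numD + 1, out.localSteps + l⟩ := by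
  set s := iterState f lam L β x₀ S K t with hs
  obtain ⟨l, hl, out, hout, hrun⟩ := run_mainRounds (m := m) f S lam L β (K t) s.x s.g
    (mean Finset.univ (syncTable f t s)) next t (syncTable f t s)
  refine ⟨l, hl, out, ?_, hrun⟩
  rw [hout]
  have e1 : (iterState f lam L β x₀ S K (t + 1)).x = cgmRand lam L (f 0) (K t) s.x s.g := rfl
  have e2 : (iterState f lam L β x₀ S K (t + 1)).b = sagaTable f t s.x (S t) s.b := rfl
  have e3 : (iterState f lam L β x₀ S K (t + 1)).g = rgUpdate f β (S t) s.x
    (cgmRand lam L (f 0) (K t) s.x s.g) s.g (sagaEstimator f t s.x (S t) s.b) := rfl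
  rw [e1, e2, e3, mean_univ_sagaTable, sagaTable_eq_syncTable, rgUpdate, gradient_meanFun hf,
    gradient_meanFun hf, sagaEstimator_eq_syncTable hf, mean_sub (S t)
      (fun i => gradient (f i) (cgmRand lam L (f 0) (K t) s.x s.g)), add_sub_assoc]

/-- Induction on the number k of iterations left. The arguments g, b and h need to agree with the
recursion only from the time when they are no longer overwritten: 1 for g, 2 for the stored vectors
and their average. Every iteration has one RSS round, so the RSS counter equals t. The number of
synchronizations still possible is the truncated difference 2 - t. -/
theorem run_mainLoop {f : Fin n → Vec d → ℝ} (hf : ∀ i, Differentiable ℝ (f i)) (hm : 1 ≤ m)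
    (hmn : m ≤ n) (lam L β : ℝ) (x₀ : Vec d) (S : ℕ → Finset (Fin n)) (K : ℕ → ℕ) (τ k t : ℕ)
    (g b out : Vec d) (h : Fin n → Vec d)
    (hg : 1 ≤ t → g = (iterState f lam L β x₀ S K t).g)
    (hb : 2 ≤ t → b = mean Finset.univ (iterState f lam L β x₀ S K t).b)
    (hh : 2 ≤ t → h = (iterState f lam L β x₀ S K t).b) (Z : Outcome d)
    (hZ : Z = (mainLoop hmn lam L β K τ k t (iterState f lam L β x₀ S K t).x g b out).run
      (fun i => firstOrderOracle (f i)) S t h) :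
    Z.output = (if t < τ ∧ τ ≤ t + k then iterate f lam L β x₀ S K τ else out) ∧
    Z.numA ≤ ⌈ratio n m⌉₊ * (2 - t) ∧ Z.numR = k ∧ Z.numD = k ∧
    Z.localSteps ≤ ⌈ratio n m⌉₊ * (2 - t) + ∑ i ∈ Finset.range k, (K (t + i) + 3) := by
  induction k generalizing t g b out h Z with
  | zero =>
    subst hZ
    simp [mainLoop, Algorithm.run]
  | succ k ih =>
    set s := iterState f lam L β x₀ S K t with hs
    set cont : Vec d → Vec d → Vec d → Algorithm n m d (Vec d) (Vec d × Vec d) := fun x' g' b' =>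
      mainLoop hmn lam L β K τ k (t + 1) x' g' b' (if t + 1 = τ then x' else out) with hcont
    obtain ⟨l, hl, Z', hZ', hrun⟩ := run_mainRounds_iterState (m := m) hf lam L β x₀ S K t cont
    obtain ⟨i1, i2, i3, i4, i5⟩ := ih (t + 1) _ _ _ _ (fun _ => rfl) (fun _ => rfl) (fun _ => rfl)
      Z' hZ'
    rw [← hs] at hrun
    have hout : Z'.output
        = (if t < τ ∧ τ ≤ t + (k + 1) then iterate f lam L β x₀ S K τ else out) := by
      rw [i1]
      -- If τ is the index just produced, the kept value must survive the remaining iterations. The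
      -- condition t + 1 < τ is then false, so they return it.
      by_cases h1 : t + 1 = τ
      · rw [if_neg (by omega), if_pos h1, if_pos (by omega), ← h1]
        rfl
      · rw [if_neg h1]
        by_cases h2 : t + 1 < τ ∧ τ ≤ t + 1 + k
        · rw [if_pos h2, if_pos (by omega)]
        · rw [if_neg h2, if_neg (by omega)]
    have hsum : ∑ i ∈ Finset.range (k + 1), (K (t + i) + 3)
        = ∑ i ∈ Finset.range k, (K (t + 1 + i) + 3) + (K t + 3) := by
      rw [Finset.sum_range_succ', add_zero]
      refine congrArg (· + _) (Finset.sum_congr rfl fun i _ => ?_)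
      rw [add_right_comm t 1 i, add_assoc]
    rw [hsum]
    by_cases ht : t ≤ 1
    · have hR : 2 - t = 2 - (t + 1) + 1 := by omega
      rw [hR, mul_add, mul_one]
      have hsync : syncTable f t s = fun i => gradient (f i) s.x := if_pos ht
      have hgt : (if t = 0 then mean Finset.univ (fun i => gradient (f i) s.x) else g) = s.g := by
        split_ifs with h0
        · subst h0
          rw [hs]
          exact (gradient_objective hf x₀).symm
        · exact hg (by omega)
      obtain ⟨q, hq, hsyncrun⟩ := run_fullSync_all hm (fun i => firstOrderOracle (f i)) S hmn s.x
        (fun table => mainRounds lam L β (K t) s.x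
          (if t = 0 then mean Finset.univ table else g) (mean Finset.univ table) cont)
        t (fun _ => 0) h
      simp only [firstOrderOracle] at hsyncrun
      rw [hsync] at hrun
      rw [hgt, hrun] at hsyncrun
      have hZrun : Z = ⟨Z'.output, Z'.numA + ⌈ratio n m⌉₊, Z'.numR + 1, Z'.numD + 1,
          Z'.localSteps + l + q⟩ := by
        rw [hZ, ← hsyncrun, mainLoop, if_pos ht]
      subst hZrun
      refine ⟨hout, ?_, ?_, ?_, ?_⟩ <;> simp only <;> omega
    · have hR : 2 - (t + 1) = 0 := by omega
      have hR' : 2 - t = 0 := by omega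
      rw [hR, mul_zero] at i2 i5
      rw [hR', mul_zero]
      have hsync : syncTable f t s = s.b := if_neg ht
      rw [hsync] at hrun
      have hZrun : Z = ⟨Z'.output, Z'.numA, Z'.numR + 1, Z'.numD + 1, Z'.localSteps + l⟩ := by
        rw [hZ, ← hrun, mainLoop, if_neg ht, hg (by omega), hb (by omega), hh (by omega)]
      subst hZrun
      refine ⟨hout, ?_, ?_, ?_, ?_⟩ <;> simp only <;> omega

theorem runICGM_spec {f : Fin n → Vec d → ℝ} (hf : ∀ i, Differentiable ℝ (f i)) (hm : 1 ≤ m)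
    (hmn : m ≤ n) (lam L β : ℝ) (x₀ : Vec d) (T : ℕ) (S : ℕ → Finset (Fin n)) (K : ℕ → ℕ) (τ : ℕ) :
    (τ ∈ Finset.Icc 1 T →
      (runICGM f hmn lam L β x₀ T S K τ).output = iterate f lam L β x₀ S K τ) ∧
    (runICGM f hmn lam L β x₀ T S K τ).numA ≤ 2 * ⌈ratio n m⌉₊ ∧
    (runICGM f hmn lam L β x₀ T S K τ).numR = T ∧
    (runICGM f hmn lam L β x₀ T S K τ).numD = T ∧
    (runICGM f hmn lam L β x₀ T S K τ).localSteps
      ≤ 2 * ⌈ratio n m⌉₊ + ∑ t ∈ Finset.range T, (K t + 3) := by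
  obtain ⟨h1, h2, h3, h4, h5⟩ := run_mainLoop hf hm hmn lam L β x₀ S K τ T 0 0 0 x₀ (fun _ => 0)
    (by omega) (by omega) (by omega) _ rfl
  simp only [zero_add, Nat.sub_zero] at h1 h2 h5
  refine ⟨fun hτ => ?_, ?_, h3, h4, ?_⟩
  · rw [Finset.mem_Icc] at hτ
    rw [if_pos (by omega)] at h1
    exact h1
  · rw [mul_comm]; exact h2
  · rw [mul_comm 2]; exact h5

end Run

/-! ### Complexity bounds -/

theorem IsRandomness.lintegral_K {Ω : Type*} [MeasurableSpace Ω] {P : Measure Ω} {p : ℝ} {T : ℕ}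
    {S : ℕ → Ω → Finset (Fin n)} {K : ℕ → Ω → ℕ} {τ : Ω → ℕ}
    (h : IsRandomness P m p T S K τ) (hp0 : 0 < p) (hp1 : p ≤ 1) (t : ℕ) :
    ∫⁻ ω, (K t ω : ℝ≥0∞) ∂P = ENNReal.ofReal ((1 - p) / p) := by
  have h1 := lintegral_map (μ := P) (f := fun k : ℕ => (k : ℝ≥0∞)) Measurable.of_discrete
    (h.measurable_K t)
  have h2 : HasSum (fun k : ℕ => (k : ℝ) * (1 - p) ^ k * p) ((1 - p) / p) := by
    have h3 := (hasSum_coe_mul_geometric_of_norm_lt_one (r := 1 - p)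
      (by rw [Real.norm_of_nonneg (by linarith)]; linarith)).mul_right p
    rwa [sub_sub_cancel, show (1 - p) / p ^ 2 * p = (1 - p) / p by field_simp] at h3
  have hnn : ∀ k : ℕ, 0 ≤ (k : ℝ) * (1 - p) ^ k * p := fun k =>
    mul_nonneg (mul_nonneg k.cast_nonneg (pow_nonneg (by linarith) _)) hp0.le
  rw [← h1, lintegral_countable', ← h2.tsum_eq, ENNReal.ofReal_tsum_of_nonneg hnn h2.summable]
  refine tsum_congr fun k => ?_
  rw [Measure.map_apply (h.measurable_K t) (measurableSet_singleton k), mul_assoc,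
    ENNReal.ofReal_mul k.cast_nonneg, ENNReal.ofReal_natCast]
  exact congrArg _ (h.law_K t k)

/-- Each summand has mean (1 - p)/p + 3 = 1/p + 2. -/
theorem IsRandomness.lintegral_sum_K {Ω : Type*} [MeasurableSpace Ω] {P : Measure Ω}
    [IsProbabilityMeasure P] {p : ℝ} {T : ℕ}
    {S : ℕ → Ω → Finset (Fin n)} {K : ℕ → Ω → ℕ} {τ : Ω → ℕ}
    (h : IsRandomness P m p T S K τ) (hp0 : 0 < p) (hp1 : p ≤ 1) (a k : ℕ) :
    ∫⁻ ω, ((a + ∑ t ∈ Finset.range k, (K t ω + 3) : ℕ) : ℝ≥0∞) ∂P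
      = ENNReal.ofReal (a + k * (1 / p + 2)) := by
  have hK : ∀ t, Measurable fun ω => (K t ω : ℝ≥0∞) := fun t =>
    (Measurable.of_discrete (f := fun k : ℕ => (k : ℝ≥0∞))).comp (h.measurable_K t)
  have hq : 0 ≤ (1 - p) / p := div_nonneg (by linarith) hp0.le
  have h1 : ∀ t ∈ Finset.range k, ∫⁻ ω, ((K t ω : ℝ≥0∞) + 3) ∂P
      = ENNReal.ofReal (1 / p + 2) := by
    intro t _
    rw [lintegral_add_left (hK t), h.lintegral_K hp0 hp1, lintegral_const, measure_univ, mul_one,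
      ← ENNReal.ofReal_ofNat 3, ← ENNReal.ofReal_add hq (by norm_num)]
    congr 1
    field_simp
    ring
  push_cast
  rw [lintegral_add_left measurable_const, lintegral_const, measure_univ, mul_one,
    lintegral_finsetSum _ fun t _ => (hK t).add_const _, Finset.sum_congr rfl h1, Finset.sum_const,
    Finset.card_range, nsmul_eq_mul,
    ENNReal.ofReal_add (p := (a : ℝ)) (q := k * (1 / p + 2)) (by positivity) (by positivity),
    ENNReal.ofReal_mul (by positivity), ENNReal.ofReal_natCast, ENNReal.ofReal_natCast]

/-- The arithmetic of the local complexity, where `s = √n_m δ_m` and `Y = F⁰ / ε²`. -/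
theorem local_complexity_arith {Δ L s Y T : ℝ} (hΔ : 0 < Δ) (hL : 0 < L) (hs : 0 ≤ s)
    (hY : 0 ≤ Y) (hT : T ≤ 256 * (Δ + 38 * s) * Y + 1) :
    T * (8 * (L + (3 * Δ + 113 * s)) / (2 * Δ + 113 * s) + 2)
      ≤ 14 + 512 * (7 * Δ + 283 * s + 2 * L) * Y + 4 * L / (Δ + 28 * s) := by
  have hM : 0 < 2 * Δ + 113 * s := by positivity
  -- This pays for the one extra iteration due to the ceiling in T. It gives the terms free of Y in
  -- the bound.
  have h1 : 8 * (L + (3 * Δ + 113 * s)) / (2 * Δ + 113 * s) + 2 ≤ 14 + 4 * L / (Δ + 28 * s) := by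
    have e1 : 8 * (L + (3 * Δ + 113 * s)) / (2 * Δ + 113 * s)
        = 8 * (3 * Δ + 113 * s) / (2 * Δ + 113 * s) + 8 * L / (2 * Δ + 113 * s) := by ring
    have h2 : 8 * (3 * Δ + 113 * s) / (2 * Δ + 113 * s) ≤ 12 := by
      rw [div_le_iff₀ hM]; linarith
    have h3 : 8 * L / (2 * Δ + 113 * s) ≤ 4 * L / (Δ + 28 * s) := by
      rw [div_le_div_iff₀ hM (by positivity)]
      nlinarith [mul_nonneg hL.le hs]
    linarith
  -- After clearing the denominator, the coefficients of Δ² and LΔ agree on both sides; those of Δs,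
  -- s² and Ls have slack.
  have h2 : (Δ + 38 * s) * (8 * (L + (3 * Δ + 113 * s)) / (2 * Δ + 113 * s) + 2)
      ≤ 2 * (7 * Δ + 283 * s + 2 * L) := by
    have e : (Δ + 38 * s) * (8 * (L + (3 * Δ + 113 * s)) / (2 * Δ + 113 * s) + 2)
        = (Δ + 38 * s) * (8 * (L + (3 * Δ + 113 * s)) + 2 * (2 * Δ + 113 * s))
          / (2 * Δ + 113 * s) := by
      field_simp
    rw [e, div_le_iff₀ hM]
    nlinarith [mul_nonneg hΔ.le hs, mul_nonneg hL.le hs, mul_nonneg hs hs, mul_pos hΔ hL]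
  have h3 := mul_le_mul_of_nonneg_right h2 (by positivity : 0 ≤ 256 * Y)
  have hpos : 0 ≤ 8 * (L + (3 * Δ + 113 * s)) / (2 * Δ + 113 * s) + 2 := by positivity
  have h4 := mul_le_mul_of_nonneg_right hT hpos
  linarith

end FedOpt

/-! ### The main theorem: choice of constants and the four claims. -/

open FedOpt in
theorem theorem2 {n m d : ℕ} [NeZero n] (hn : 2 ≤ n) (hm : 1 ≤ m) (hmn : m ≤ n)
    (f : Fin n → Vec d → ℝ) (hf : ∀ i, Differentiable ℝ (f i))
    (hbdd : BddBelow (Set.range (objective f)))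
    (Δ₁ δ L₁ : ℝ) (hΔ₁ : 0 < Δ₁) (hδ : 0 < δ) (hL₁ : 0 < L₁)
    (hED : ∀ x y : Vec d,
      ‖gradient (diffFun f 0) x - gradient (diffFun f 0) y‖ ≤ Δ₁ * ‖x - y‖)
    (hSOD : ∀ x y : Vec d,
      (1 / (n : ℝ)) * ∑ i, ‖gradient (diffFun f i) x - gradient (diffFun f i) y‖ ^ 2
        ≤ δ ^ 2 * ‖x - y‖ ^ 2)
    (hL : ∀ x y : Vec d, ‖gradient (f 0) x - gradient (f 0) y‖ ≤ L₁ * ‖x - y‖)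
    (x₀ : Vec d) (hx₀ : 0 < initialGap f x₀)
    (ε : ℝ) (hε : 0 < ε)
    (C_A C_R : ℝ) (hCR : 1 ≤ C_R) (hCA : C_R ≤ C_A)
    (lam β p : ℝ) (T : ℕ)
    (hlam : lam = 3 * Δ₁ + 113 * √(ratio n m) * deltaM n m δ)
    (hβ : β = 1 / (112 * ratio n m))
    (hp : p = (lam - Δ₁) / (8 * (L₁ + lam)))
    (hT : T = ⌈256 * (Δ₁ + 38 * √(ratio n m) * deltaM n m δ) * initialGap f x₀ / ε ^ 2⌉₊)
    {Ω : Type*} [MeasurableSpace Ω] (P : MeasureTheory.Measure Ω)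
    [MeasureTheory.IsProbabilityMeasure P]
    (S : ℕ → Ω → Finset (Fin n)) (K : ℕ → Ω → ℕ) (τ : Ω → ℕ)
    (hrand : IsRandomness P m p T S K τ)
    (xbar : Ω → Vec d)
    (hxbar : ∀ ω, xbar ω = iterate f lam L₁ β x₀ (fun t => S t ω) (fun t => K t ω) (τ ω))
    (Z : Ω → Outcome d)
    (hZ : ∀ ω, Z ω = runICGM f hmn lam L₁ β x₀ T (fun t => S t ω) (fun t => K t ω) (τ ω)) :
    (∫⁻ ω, ENNReal.ofReal (‖gradient (objective f) (xbar ω)‖ ^ 2) ∂P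
        ≤ ENNReal.ofReal (ε ^ 2)) ∧
    (∀ᵐ ω ∂P, (Z ω).output = xbar ω) ∧
    commComplexity P C_A C_R Z
      ≤ ENNReal.ofReal (2 * C_A * ⌈ratio n m⌉₊ + (C_R + 1) *
          ⌈256 * (Δ₁ + 38 * √(ratio n m) * deltaM n m δ) * initialGap f x₀ / ε ^ 2⌉₊) ∧
    localComplexity P Z
      ≤ ENNReal.ofReal (14 + 2 * ⌈ratio n m⌉₊
          + 512 * (7 * Δ₁ + 283 * √(ratio n m) * deltaM n m δ + 2 * L₁)
              * initialGap f x₀ / ε ^ 2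
          + 4 * L₁ / (Δ₁ + 28 * √(ratio n m) * deltaM n m δ)) := by
  rw [← hT]
  simp only [mul_assoc _ √(ratio n m) (deltaM n m δ)] at hlam hT ⊢
  have hQ0 := samplingFactor_nonneg (m := m) hn hmn
  have hρ0 : 0 ≤ ratio n m := by rw [ratio]; positivity
  have hs2 : (√(ratio n m) * deltaM n m δ) ^ 2
      = ratio n m * (samplingFactor n m * δ ^ 2) := by
    rw [mul_pow, Real.sq_sqrt hρ0, deltaM, ← samplingFactor, Real.sq_sqrt (by positivity)]
  have hs0 : 0 ≤ √(ratio n m) * deltaM n m δ :=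
    mul_nonneg (Real.sqrt_nonneg _) (Real.sqrt_nonneg _)
  set s := √(ratio n m) * deltaM n m δ
  set F := initialGap f x₀ with hF
  have hM : lam - Δ₁ = 2 * Δ₁ + 113 * s := by rw [hlam]; ring
  -- Here 12769 = 113², and M = 2Δ₁ + 113s ≥ 113s.
  have hMδ : 12769 * (ratio n m * (samplingFactor n m * δ ^ 2)) ≤ (lam - Δ₁) ^ 2 := by
    rw [← hs2, hM]
    nlinarith [mul_nonneg hΔ₁.le hs0, mul_pos hΔ₁ hΔ₁]
  have hε2 : 0 < ε ^ 2 := by positivity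
  have hX0 : 0 < 256 * (Δ₁ + 38 * s) * F / ε ^ 2 := by positivity
  have hT1 : 1 ≤ T := by rw [hT]; exact Nat.one_le_ceil_iff.2 hX0
  have hTle : 256 * (Δ₁ + 38 * s) * F / ε ^ 2 ≤ T := by rw [hT]; exact Nat.le_ceil _
  have hTlt : (T : ℝ) < 256 * (Δ₁ + 38 * s) * F / ε ^ 2 + 1 := by
    rw [hT]; exact Nat.ceil_lt_add_one hX0.le
  have hT0 : (0 : ℝ) < T := by exact_mod_cast hT1
  have hlam0 : 0 < lam := by rw [hlam]; positivity
  have hMpos : 0 < lam - Δ₁ := by rw [hM]; positivity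
  have hp0 : 0 < p := by rw [hp]; positivity
  have hp1 : p ≤ 1 := by
    rw [hp, div_le_one (by positivity)]; linarith
  have hspec := fun ω => runICGM_spec hf hm hmn lam L₁ β x₀ T (fun t => S t ω) (fun t => K t ω)
    (τ ω)
  refine ⟨?_, ?_, ?_, ?_⟩
  · have h := lintegral_gradSq_random_iterate_le (x₀ := x₀) hf hn hm hmn hL₁ hΔ₁.le
      (sub_pos.1 hMpos) (by rw [hlam]; linarith) hED hSOD hL (fun x => ciInf_le hbdd x) hβ hp hMδ
      hrand hT1
    simp only [← hxbar] at h
    refine h.trans (ENNReal.ofReal_le_ofReal ?_)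
    -- It suffices that 70(2Δ₁ + 113s) = 140Δ₁ + 7910s is at most 256(Δ₁ + 38s) = 256Δ₁ + 9728s.
    have hTε := (div_le_iff₀ hε2).1 hTle
    rw [← initialGap, ← hF, div_le_iff₀ hT0, hM]
    nlinarith [mul_nonneg hΔ₁.le hx₀.le, mul_nonneg hs0 hx₀.le]
  · filter_upwards [hrand.ae_mem_Icc hT1] with ω hω
    rw [hZ, hxbar]
    exact (hspec ω).1 hω
  · have h : ∀ ω, ENNReal.ofReal (C_A * (Z ω).numA + C_R * (Z ω).numR + (Z ω).numD)
        ≤ ENNReal.ofReal (2 * C_A * ⌈ratio n m⌉₊ + (C_R + 1) * T) := by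
      intro ω
      obtain ⟨-, hA, hR, hD, -⟩ := hspec ω
      rw [hZ, hR, hD]
      refine ENNReal.ofReal_le_ofReal ?_
      have hA' : ((runICGM f hmn lam L₁ β x₀ T (fun t => S t ω) (fun t => K t ω) (τ ω)).numA : ℝ)
          ≤ 2 * ⌈ratio n m⌉₊ := by exact_mod_cast hA
      have := mul_le_mul_of_nonneg_left hA' (by linarith : 0 ≤ C_A)
      linarith
    refine (lintegral_mono h).trans (le_of_eq ?_)
    rw [lintegral_const, measure_univ, mul_one]
  · have h : ∀ ω, ((Z ω).localSteps : ℝ≥0∞)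
        ≤ ((2 * ⌈ratio n m⌉₊ + ∑ t ∈ Finset.range T, (K t ω + 3) : ℕ) : ℝ≥0∞) := by
      intro ω
      rw [hZ]
      exact_mod_cast (hspec ω).2.2.2.2
    refine (lintegral_mono h).trans ((le_of_eq (hrand.lintegral_sum_K hp0 hp1 _ _)).trans
      (ENNReal.ofReal_le_ofReal ?_))
    have h1 : 1 / p = 8 * (L₁ + (3 * Δ₁ + 113 * s)) / (2 * Δ₁ + 113 * s) := by
      rw [hp, one_div_div, hM, hlam]
    have h2 := local_complexity_arith (T := T) (Y := F / ε ^ 2) hΔ₁ hL₁ hs0 (by positivity)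
      (by rw [← mul_div_assoc]; exact hTlt.le)
    rw [h1]
    rw [← mul_div_assoc] at h2
    push_cast
    linarith
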